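/- **Setting.** An $\ell$-algebra is a commutative unital $\mathbb R$-algebra $A$ with a lattice order such that $a\le b$ implies $a+c\le b+c$, and $0\le a,b$, $0\le r\in\mathbb R$ imply $0\le ab$, $0\le ra$. It is bounded if every $a\in A$ satisfies $a\le n\cdot 1$ for some $n\in\mathbb N$, and archimedean if $na\le b$ for all $n\in\mathbb N$ implies $a\le 0$. Let $\boldsymbol{ba\ell}$ be the category of bounded archimedean $\ell$-algebras (the zero algebra included) and unital $\mathbb R$-algebra homomorphisms that preserve $\vee,\wedge$. Put $\|a\|=\inf\{r\ge 0: |a|\le r\cdot 1\}$; $A$ is uniformly complete if it is complete for this norm. *Gelfand functors.* $\mathsf{KHaus}$ is the category of compact Hausdorff spaces and continuous maps. $\mathsf C:\mathsf{KHaus}\to\boldsymbol{ba\ell}$ is the contravariant functor $X\mapsto C(X)$ (continuous real functions), $\varphi\mapsto(f\mapsto f\circ\varphi)$. An $\ell$-ideal of $A$ is an ideal $I$ such that $|a|\le|b|$, $b\in I$ imply $a\in I$. $\mathsf Y:\boldsymbol{ba\ell}\to\mathsf{KHaus}$ is the contravariant functor sending $A$ to the space $Y_A$ of maximal $\ell$-ideals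 of $A$, whose closed sets are the sets $\{M: I\subseteq M\}$ for $\ell$-ideals $I$, and a morphism $\alpha$ to $M\mapsto\alpha^{-1}(M)$. Let $\zeta_A:A\to C(Y_A)$ be given by $\zeta_A(a)(M)=r$, where $r$ is the unique real number with $a-r\cdot 1\in M$, and let $\varepsilon_X:X\to Y_{C(X)}$ be given by $\varepsilon_X(x)=\{f: f(x)=0\}$ (a homeomorphism). *The functor $\mathsf V$.* $\mathsf V:\mathsf{KHaus}\to\mathsf{KHaus}$ is the Vietoris functor: $\mathsf V(X)$ is the set of all closed subsets of $X$, including $\varnothing$, with the topology generated by the sets $\{F: F\subseteq U\}$ and $\{F: F\cap U\neq\varnothing\}$ for $U$ open in $X$, and $\mathsf V(\varphi)(F)=\varphi(F)$. *The functor $\mathsf H$.* For $A\in\boldsymbol{ba\ell}$ let $w_A(a)=\max\{\|a\|,1\}$ and let $f_A:A\to F(A)$ be the free object of $\boldsymbol{ba\ell}$ over the weighted set $(A,w_A)$, i.e. the universal map $f$ from the set $A$ to an object of $\boldsymbol{ba\ell}$ with $\|f(a)\|\le w_A(a)$ for all $a$. An $\ell$-ideal is archimedean if its quotient is archimedean.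 Let $\mathsf H(A)$ be the quotient of $F(A)$ by the archimedean $\ell$-ideal generated by the elements $$f_A(a\wedge b)-f_A(a)\wedge f_A(b),\quad f_A(r)-r-(1-r)f_A(0),\quad f_A(a\vee 0)-f_A(a)\vee 0,$$ $$f_A(a+r)-f_A(a)-f_A(r)+f_A(0),\qquad f_A(sa)-f_A(s)f_A(a)$$ for $a,b\in A$, $r\in\mathbb R$, $0\le s\in\mathbb R$ (a real number $r$ is identified with $r\cdot 1$), and let $\Box_a\in\mathsf H(A)$ be the class of $f_A(a)$. For a morphism $\alpha:A\to B$, $\mathsf H(\alpha)$ is the unique morphism with $\mathsf H(\alpha)(\Box_a)=\Box_{\alpha(a)}$ for all $a\in A$. Let $\eta_A:\mathsf H(A)\to C(\mathsf V Y_A)$ be the unique morphism with $\eta_A(\Box_a)(F)=\inf\zeta_A(a)(F)$ for $F\ne\varnothing$ and $\eta_A(\Box_a)(\varnothing)=1$; the map $\mathsf Y(\eta_A)$ is a homeomorphism. *Algebras and coalgebras.* $\mathsf{Alg}(\mathsf H)$ is the category of algebras $(A,\alpha:\mathsf H(A)\to A)$ for the endofunctor $\mathsf H$ of $\boldsymbol{ba\ell}$,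 $\mathsf{Coalg}(\mathsf V)$ is the category of coalgebras $(X,\sigma:X\to\mathsf V(X))$ for $\mathsf V$, and $\mathsf{Alg}^u(\mathsf H)$ is the full subcategory of $\mathsf{Alg}(\mathsf H)$ of those $(A,\alpha)$ with $A$ uniformly complete. The contravariant functors $\mathsf F:\mathsf{Alg}(\mathsf H)\to\mathsf{Coalg}(\mathsf V)$ and $\mathsf G:\mathsf{Coalg}(\mathsf V)\to\mathsf{Alg}(\mathsf H)$ are $$\mathsf F(A,\alpha)=\bigl(Y_A,\ \varepsilon_{\mathsf V(Y_A)}^{-1}\circ\mathsf Y(\eta_A)^{-1}\circ\mathsf Y(\alpha)\bigr),\qquad \mathsf F(\gamma)=\mathsf Y(\gamma),$$ $$\mathsf G(X,\sigma)=\bigl(C(X),\ \mathsf C(\sigma)\circ\mathsf C\mathsf V(\varepsilon_X)\circ\eta_{C(X)}\bigr),\qquad \mathsf G(\varphi)=\mathsf C(\varphi).$$ **Corollary.** 1. $\mathsf G$ takes values in $\mathsf{Alg}^u(\mathsf H)$, and the functors $\mathsf F$ and $\mathsf G$ restrict to a dual (adjoint) equivalence between $\mathsf{Alg}^u(\mathsf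 H)$ and $\mathsf{Coalg}(\mathsf V)$. It lifts Gelfand duality: its natural isomorphisms $1\to\mathsf G\mathsf F$ on $\mathsf{Alg}^u(\mathsf H)$ and $1\to\mathsf F\mathsf G$ on $\mathsf{Coalg}(\mathsf V)$ have the components $\zeta_A$ at $(A,\alpha)$ and $\varepsilon_X$ at $(X,\sigma)$. 2. $\mathsf{Alg}^u(\mathsf H)$ is a reflective subcategory of $\mathsf{Alg}(\mathsf H)$. -/

import Mathlib

open CategoryTheory TopologicalSpace

universe u

set_option linter.unusedSectionVars false

namespace VietorisDuality

/-! ## Lattice-ordered algebras -/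

/-- `A` is a (real) `ℓ`-algebra: a commutative real algebra with a lattice order for which
translations are monotone and products of nonnegative elements, and nonnegative real multiples of
nonnegative elements, are nonnegative. -/
class IsLAlgebra (A : Type u) [CommRing A] [Lattice A] [Algebra ℝ A] : Prop where
  add_le_add' : ∀ a b c : A, a ≤ b → a + c ≤ b + c
  mul_nonneg' : ∀ a b : A, 0 ≤ a → 0 ≤ b → 0 ≤ a * b
  smul_nonneg' : ∀ (r : ℝ) (a : A), 0 ≤ r → 0 ≤ a → 0 ≤ r • a

/-- `1` is a strong order unit. -/
def IsBounded (A : Type u) [CommRing A] [Lattice A] : Prop :=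
  ∀ a : A, ∃ n : ℕ, a ≤ n • (1 : A)

/-- The archimedean property. -/
def IsArchimedean (A : Type u) [CommRing A] [Lattice A] : Prop :=
  ∀ a b : A, (∀ n : ℕ, n • a ≤ b) → a ≤ 0

/-- Bounded archimedean `ℓ`-algebras. -/
class IsBAL (A : Type u) [CommRing A] [Lattice A] [Algebra ℝ A] : Prop extends IsLAlgebra A where
  bounded : IsBounded A
  archimedean : IsArchimedean A

/-- Unital `ℓ`-algebra morphisms: unital real algebra homomorphisms that are lattice
homomorphisms. -/
structure LAlgHom (A B : Type*) [CommRing A] [Lattice A] [Algebra ℝ A]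
    [CommRing B] [Lattice B] [Algebra ℝ B] extends A →ₐ[ℝ] B where
  map_sup' : ∀ a b : A, toFun (a ⊔ b) = toFun a ⊔ toFun b
  map_inf' : ∀ a b : A, toFun (a ⊓ b) = toFun a ⊓ toFun b

namespace LAlgHom

section
variable {A B D : Type*} [CommRing A] [Lattice A] [Algebra ℝ A]
  [CommRing B] [Lattice B] [Algebra ℝ B] [CommRing D] [Lattice D] [Algebra ℝ D]

instance : FunLike (LAlgHom A B) A B where
  coe f := f.toFun
  coe_injective f g h := by
    rcases f with ⟨f, _, _⟩; rcases g with ⟨g, _, _⟩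
    have : f = g := AlgHom.ext fun x => congrFun h x
    subst this; rfl

instance : AlgHomClass (LAlgHom A B) ℝ A B where
  map_mul f := map_mul f.toAlgHom
  map_one f := map_one f.toAlgHom
  map_add f := map_add f.toAlgHom
  map_zero f := map_zero f.toAlgHom
  commutes f := f.toAlgHom.commutes

@[ext] theorem ext {f g : LAlgHom A B} (h : ∀ a, f a = g a) : f = g := DFunLike.ext _ _ h

theorem map_sup (f : LAlgHom A B) (a b : A) : f (a ⊔ b) = f a ⊔ f b := f.map_sup' a b
theorem map_inf (f : LAlgHom A B) (a b : A) : f (a ⊓ b) = f a ⊓ f b := f.map_inf' a b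
theorem map_real (f : LAlgHom A B) (r : ℝ) : f (algebraMap ℝ A r) = algebraMap ℝ B r :=
  f.toAlgHom.commutes r

theorem map_abs (f : LAlgHom A B) (a : A) : f |a| = |f a| := by
  simp only [abs, map_sup, map_neg]

theorem mono (f : LAlgHom A B) {a b : A} (h : a ≤ b) : f a ≤ f b := by
  rw [← sup_eq_right, ← map_sup, sup_eq_right.2 h]

/-- The identity morphism. -/
def id (A : Type*) [CommRing A] [Lattice A] [Algebra ℝ A] : LAlgHom A A where
  toAlgHom := AlgHom.id ℝ A
  map_sup' _ _ := rfl
  map_inf' _ _ := rfl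

/-- Composition of morphisms. -/
def comp (g : LAlgHom B D) (f : LAlgHom A B) : LAlgHom A D where
  toAlgHom := g.toAlgHom.comp f.toAlgHom
  map_sup' a b := by
    change g (f (a ⊔ b)) = g (f a) ⊔ g (f b)
    rw [map_sup, map_sup]
  map_inf' a b := by
    change g (f (a ⊓ b)) = g (f a) ⊓ g (f b)
    rw [map_inf, map_inf]

@[simp] theorem id_apply (a : A) : LAlgHom.id A a = a := rfl
@[simp] theorem comp_apply (g : LAlgHom B D) (f : LAlgHom A B) (a : A) :
    g.comp f a = g (f a) := rfl
end

end LAlgHom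

section Order

instance (priority := 50) {A : Type*} [CommRing A] [Lattice A] [Algebra ℝ A] [IsLAlgebra A] :
    IsOrderedAddMonoid A where
  add_le_add_left a b h c := IsLAlgebra.add_le_add' a b c h

theorem zero_le_one_of_bounded {A : Type*} [CommRing A] [Lattice A] [Algebra ℝ A] [IsLAlgebra A]
    (h : IsBounded A) : (0 : A) ≤ 1 := by
  obtain ⟨n, hn⟩ := h |1|
  rcases Nat.eq_zero_or_pos n with rfl | hpos
  · have h1 : (1 : A) ≤ 0 := (le_abs_self 1).trans (by simpa using hn)
    have h2 : (-1 : A) ≤ 0 := (neg_le_abs 1).trans (by simpa using hn)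
    simpa using h2
  · have h0 : (0 : A) ≤ n • (1 : A) := (abs_nonneg 1).trans hn
    have := IsLAlgebra.smul_nonneg' ((n : ℝ)⁻¹) _ (by positivity) h0
    rwa [← Nat.cast_smul_eq_nsmul ℝ, smul_smul, inv_mul_cancel₀ (by positivity), one_smul] at this

instance (priority := 50) {A : Type*} [CommRing A] [Lattice A] [Algebra ℝ A] [IsBAL A] :
    IsOrderedRing A :=
  haveI : ZeroLEOneClass A := ⟨zero_le_one_of_bounded IsBAL.bounded⟩
  IsOrderedRing.of_mul_nonneg IsLAlgebra.mul_nonneg'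

variable {A : Type*} [CommRing A] [Lattice A] [Algebra ℝ A] [IsBAL A]

theorem real_nonneg {r : ℝ} (h : 0 ≤ r) : (0 : A) ≤ algebraMap ℝ A r := by
  rw [Algebra.algebraMap_eq_smul_one]
  exact IsLAlgebra.smul_nonneg' r 1 h zero_le_one

theorem real_mono {r s : ℝ} (h : r ≤ s) : algebraMap ℝ A r ≤ algebraMap ℝ A s := by
  have := real_nonneg (A := A) (sub_nonneg.2 h)
  rwa [map_sub, sub_nonneg] at this

theorem real_sup (r s : ℝ) : algebraMap ℝ A (r ⊔ s) = algebraMap ℝ A r ⊔ algebraMap ℝ A s := by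
  rcases le_total r s with h | h
  · rw [sup_eq_right.2 h, sup_eq_right.2 (real_mono h)]
  · rw [sup_eq_left.2 h, sup_eq_left.2 (real_mono h)]

theorem real_inf (r s : ℝ) : algebraMap ℝ A (r ⊓ s) = algebraMap ℝ A r ⊓ algebraMap ℝ A s := by
  rcases le_total r s with h | h
  · rw [inf_eq_left.2 h, inf_eq_left.2 (real_mono h)]
  · rw [inf_eq_right.2 h, inf_eq_right.2 (real_mono h)]

theorem abs_real (r : ℝ) : |algebraMap ℝ A r| = algebraMap ℝ A |r| := by
  simp only [abs, real_sup, map_neg]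

theorem exists_abs_le (a : A) : ∃ n : ℕ, 0 < n ∧ |a| ≤ n • (1 : A) := by
  obtain ⟨n, hn⟩ := IsBAL.bounded |a|
  exact ⟨n + 1, Nat.succ_pos n, hn.trans (nsmul_le_nsmul_left zero_le_one (Nat.le_succ n))⟩

theorem nsmul_one_eq_real (n : ℕ) : n • (1 : A) = algebraMap ℝ A n := by
  simp

theorem neg_of_abs_le {a b : A} (h : |a| ≤ b) : -b ≤ a := by
  rw [neg_le]; exact (neg_le_abs a).trans h

theorem abs_le_of {a b : A} (h1 : -b ≤ a) (h2 : a ≤ b) : |a| ≤ b :=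
  sup_le h2 (neg_le.1 h1)

theorem abs_sup_sub_sup (a b c d : A) : |a ⊔ b - c ⊔ d| ≤ |a - c| + |b - d| := by
  have h : a ⊔ b - c ⊔ d = (a ⊔ b - c ⊔ b) + (b ⊔ c - d ⊔ c) := by
    rw [sup_comm b c, sup_comm d c]; abel
  rw [h]
  exact (abs_add_le _ _).trans
    (add_le_add (abs_sup_sub_sup_le_abs a c b) (abs_sup_sub_sup_le_abs b d c))

theorem abs_inf_sub_inf (a b c d : A) : |a ⊓ b - c ⊓ d| ≤ |a - c| + |b - d| := by
  have h : a ⊓ b - c ⊓ d = (a ⊓ b - c ⊓ b) + (b ⊓ c - d ⊓ c) := by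
    rw [inf_comm b c, inf_comm d c]; abel
  rw [h]
  exact (abs_add_le _ _).trans
    (add_le_add (abs_inf_sub_inf_le_abs a c b) (abs_inf_sub_inf_le_abs b d c))

theorem abs_mul_le_of_le {a b M N : A} (h1 : |a| ≤ M) (h2 : |b| ≤ N) :
    |a * b| ≤ 3 * (M * N) := by
  have a1 := (le_abs_self a).trans h1
  have a2 := neg_of_abs_le h1
  have b1 := (le_abs_self b).trans h2
  have b2 := neg_of_abs_le h2
  have hM : 0 ≤ M := (abs_nonneg _).trans h1
  have hN : 0 ≤ N := (abs_nonneg _).trans h2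
  have p1 := mul_nonneg (sub_nonneg.2 a1) (sub_nonneg.2 b1)
  have p3 := mul_nonneg (sub_nonneg.2 a1) (sub_nonneg.2 b2)
  have q1 := mul_nonneg hM (sub_nonneg.2 b1)
  have q2 := mul_nonneg hM (sub_nonneg.2 b2)
  have q4 := mul_nonneg hN (sub_nonneg.2 a2)
  refine abs_le_of ?_ ?_
  · rw [← sub_nonneg]
    have : a * b - -(3 * (M * N)) = (M - a) * (N - b) + M * (b - -N) + N * (a - -M) := by ring
    rw [this]
    exact add_nonneg (add_nonneg p1 q2) q4
  · rw [← sub_nonneg]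
    have : 3 * (M * N) - a * b = (M - a) * (b - -N) + M * (N - b) + N * (a - -M) := by ring
    rw [this]
    exact add_nonneg (add_nonneg p3 q1) q4

theorem inf_add_le {x y z : A} (hx : 0 ≤ x) (hy : 0 ≤ y) (hz : 0 ≤ z) :
    x ⊓ (y + z) ≤ x ⊓ y + x ⊓ z := by
  rw [← sub_le_iff_le_add', sub_eq_add_neg, neg_inf, add_sup]
  refine sup_le ?_ ?_
  · refine le_trans ?_ (le_inf hx hz)
    rw [← sub_eq_add_neg, sub_nonpos]
    exact inf_le_left
  · rw [← sub_eq_add_neg]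
    refine le_inf ?_ ?_
    · exact (sub_le_self _ hy).trans inf_le_left
    · rw [sub_le_iff_le_add']; exact inf_le_right

theorem inf_nsmul_le {x y : A} (hx : 0 ≤ x) (hy : 0 ≤ y) (n : ℕ) : x ⊓ n • y ≤ n • (x ⊓ y) := by
  induction n with
  | zero => simp
  | succ n ih =>
    rw [succ_nsmul, succ_nsmul]
    exact (inf_add_le hx (nsmul_nonneg hy n) hy).trans (add_le_add_left ih _)

end Order

/-! ## The norm -/

section Norm

/-- The norm of a bounded archimedean `ℓ`-algebra: the infimum of the real numbers `r` with
`|a| ≤ r · 1`. (In a nonzero algebra `0 ≤ r` is automatic; asking for it makes the norm of the zero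
algebra zero.) -/
noncomputable def norm {A : Type*} [CommRing A] [Lattice A] [Algebra ℝ A] (a : A) : ℝ :=
  sInf {r : ℝ | 0 ≤ r ∧ |a| ≤ algebraMap ℝ A r}

variable {A : Type*} [CommRing A] [Lattice A] [Algebra ℝ A]

theorem norm_bddBelow (a : A) : BddBelow {r : ℝ | 0 ≤ r ∧ |a| ≤ algebraMap ℝ A r} :=
  ⟨0, fun _ h => h.1⟩

theorem norm_nonneg (a : A) : 0 ≤ norm a := Real.sInf_nonneg fun _ h => h.1

theorem norm_le {a : A} {r : ℝ} (hr : 0 ≤ r) (h : |a| ≤ algebraMap ℝ A r) : norm a ≤ r :=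
  csInf_le (norm_bddBelow a) ⟨hr, h⟩

theorem le_of_forall_pos [IsBAL A] {a b : A}
    (h : ∀ ε : ℝ, 0 < ε → a ≤ b + algebraMap ℝ A ε) : a ≤ b := by
  rw [← sub_nonpos]
  refine IsBAL.archimedean _ 1 fun n => ?_
  rcases Nat.eq_zero_or_pos n with rfl | hn
  · simp
  · have h1 := h ((n : ℝ)⁻¹) (by positivity)
    have h2 : a - b ≤ algebraMap ℝ A ((n : ℝ)⁻¹) := by rwa [sub_le_iff_le_add']
    have h3 := nsmul_le_nsmul_right h2 n
    refine h3.trans (le_of_eq ?_)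
    rw [nsmul_eq_mul, ← map_natCast (algebraMap ℝ A), ← map_mul,
      mul_inv_cancel₀ (by positivity), map_one]

theorem abs_le_norm [IsBAL A] (a : A) : |a| ≤ algebraMap ℝ A (norm a) := by
  refine le_of_forall_pos fun ε hε => ?_
  have hne : {r : ℝ | 0 ≤ r ∧ |a| ≤ algebraMap ℝ A r}.Nonempty := by
    obtain ⟨n, _, hn⟩ := exists_abs_le a
    exact ⟨n, by positivity, by rwa [nsmul_one_eq_real] at hn⟩
  obtain ⟨r, ⟨_, hr⟩, hlt⟩ := exists_lt_of_csInf_lt hne (lt_add_of_pos_right (norm a) hε)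
  rw [← map_add]
  exact hr.trans (real_mono hlt.le)

theorem norm_map_le {B : Type*} [CommRing B] [Lattice B] [Algebra ℝ B] [IsBAL A]
    (f : LAlgHom A B) (a : A) : norm (f a) ≤ norm a := by
  refine norm_le (norm_nonneg a) ?_
  rw [← f.map_abs, ← f.map_real]
  exact f.mono (abs_le_norm a)

/-- Uniform completeness: every Cauchy sequence for the norm converges for the norm. -/
def IsUniformlyComplete (A : Type u) [CommRing A] [Lattice A] [Algebra ℝ A] : Prop :=
  ∀ s : ℕ → A, (∀ ε : ℝ, 0 < ε → ∃ N, ∀ m n, N ≤ m → N ≤ n → norm (s m - s n) < ε) →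
    ∃ a : A, ∀ ε : ℝ, 0 < ε → ∃ N, ∀ n, N ≤ n → norm (s n - a) < ε

end Norm

/-! ## The category of bounded archimedean `ℓ`-algebras -/

/-- Bounded archimedean `ℓ`-algebras. -/
structure BAL : Type (u + 1) where
  carrier : Type u
  [commRing : CommRing carrier]
  [lattice : Lattice carrier]
  [algebra : Algebra ℝ carrier]
  [isBAL : IsBAL carrier]

namespace BAL

instance : CoeSort BAL.{u} (Type u) := ⟨BAL.carrier⟩

attribute [instance] commRing lattice algebra isBAL

instance : Category BAL.{u} where
  Hom A B := LAlgHom A B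
  id A := LAlgHom.id A
  comp f g := g.comp f

instance : ConcreteCategory BAL.{u} (fun A B => LAlgHom A B) where
  hom f := f
  ofHom f := f

/-- Regard a morphism of `ℓ`-algebras as a morphism in the category. -/
abbrev ofHom {A B : BAL.{u}} (f : LAlgHom A B) : A ⟶ B := f

/-- The underlying morphism of `ℓ`-algebras. -/
abbrev toHom {A B : BAL.{u}} (f : A ⟶ B) : LAlgHom A B := f

end BAL

/-! ## `ℓ`-ideals -/

/-- An `ℓ`-ideal: an ideal `I` such that `|a| ≤ |b|` and `b ∈ I` imply `a ∈ I`. -/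
structure LIdeal (A : Type u) [CommRing A] [Lattice A] where
  toIdeal : Ideal A
  solid : ∀ a b : A, |a| ≤ |b| → b ∈ toIdeal → a ∈ toIdeal

namespace LIdeal

section
variable {A : Type u} [CommRing A] [Lattice A]

theorem toIdeal_injective : Function.Injective (toIdeal : LIdeal A → Ideal A) := by
  rintro ⟨I, _⟩ ⟨J, _⟩ h; cases h; rfl

instance : SetLike (LIdeal A) A where
  coe I := I.toIdeal
  coe_injective _ _ h := toIdeal_injective (SetLike.coe_injective h)

/-- `ℓ`-ideals are ordered by inclusion. -/
instance : PartialOrder (LIdeal A) := PartialOrder.ofSetLike (LIdeal A) A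

theorem le_def {I J : LIdeal A} : I ≤ J ↔ ∀ a ∈ I, a ∈ J := Iff.rfl

theorem mem_toIdeal {I : LIdeal A} {a : A} : a ∈ I.toIdeal ↔ a ∈ I := Iff.rfl

instance : AddSubgroupClass (LIdeal A) A where
  add_mem {I} _ _ ha hb := I.toIdeal.add_mem ha hb
  zero_mem I := I.toIdeal.zero_mem
  neg_mem {I} _ ha := I.toIdeal.neg_mem ha

theorem mul_mem_left (I : LIdeal A) (a : A) {b : A} (h : b ∈ I) : a * b ∈ I :=
  I.toIdeal.mul_mem_left a h

theorem mem_of_abs_le (I : LIdeal A) {a b : A} (h : |a| ≤ |b|) (hb : b ∈ I) : a ∈ I :=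
  I.solid a b h hb

/-- The intersection of a set of `ℓ`-ideals. -/
def sInter (S : Set (LIdeal A)) : LIdeal A where
  toIdeal := sInf (toIdeal '' S)
  solid _ b h hb := by
    simp only [Submodule.mem_sInf, Set.forall_mem_image] at hb ⊢
    exact fun I hI => I.solid _ b h (hb hI)

theorem mem_sInter {S : Set (LIdeal A)} {a : A} : a ∈ sInter S ↔ ∀ I ∈ S, a ∈ I := by
  rw [← mem_toIdeal]
  simp only [sInter, Submodule.mem_sInf, Set.forall_mem_image]
  rfl

/-- The `ℓ`-ideal generated by a set. -/
def span (S : Set A) : LIdeal A := sInter {I | S ⊆ I}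

theorem span_le {S : Set A} {I : LIdeal A} : span S ≤ I ↔ S ⊆ I :=
  ⟨fun h _ ha => h (mem_sInter.2 fun _ hJ => hJ ha), fun h _ ha => mem_sInter.1 ha I h⟩

/-- A maximal `ℓ`-ideal: maximal among the proper `ℓ`-ideals. -/
def IsMaximal (M : LIdeal A) : Prop :=
  (1 : A) ∉ M ∧ ∀ J : LIdeal A, M ≤ J → (1 : A) ∉ J → J = M

end

section
variable {A : Type u} [CommRing A] [Lattice A] [Algebra ℝ A] [IsBAL A] (I : LIdeal A)
variable {I}

theorem abs_mem {a : A} : |a| ∈ I ↔ a ∈ I :=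
  ⟨fun h => I.mem_of_abs_le (by rw [abs_abs]) h, fun h => I.mem_of_abs_le (by rw [abs_abs]) h⟩

theorem mem_of_le {a b : A} (h : |a| ≤ b) (hb : b ∈ I) : a ∈ I :=
  I.mem_of_abs_le (h.trans (le_abs_self b)) hb

theorem mem_of_nonneg_of_le {a b : A} (ha : 0 ≤ a) (h : a ≤ b) (hb : b ∈ I) : a ∈ I :=
  mem_of_le (by rwa [abs_of_nonneg ha]) hb

theorem sup_sub_sup_mem {a b c d : A} (h1 : a - c ∈ I) (h2 : b - d ∈ I) :
    a ⊔ b - c ⊔ d ∈ I :=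
  mem_of_le (abs_sup_sub_sup a b c d) (add_mem (abs_mem.2 h1) (abs_mem.2 h2))

theorem inf_sub_inf_mem {a b c d : A} (h1 : a - c ∈ I) (h2 : b - d ∈ I) :
    a ⊓ b - c ⊓ d ∈ I :=
  mem_of_le (abs_inf_sub_inf a b c d) (add_mem (abs_mem.2 h1) (abs_mem.2 h2))

/-- The quotient of an algebra by an `ℓ`-ideal. -/
def Quot (I : LIdeal A) : Type u := A ⧸ I.toIdeal

noncomputable instance (I : LIdeal A) : CommRing I.Quot :=
  inferInstanceAs (CommRing (A ⧸ I.toIdeal))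

noncomputable instance (I : LIdeal A) : Algebra ℝ I.Quot :=
  inferInstanceAs (Algebra ℝ (A ⧸ I.toIdeal))

/-- The quotient map. -/
def proj (I : LIdeal A) : A →ₐ[ℝ] I.Quot := Ideal.Quotient.mkₐ ℝ I.toIdeal

theorem proj_surjective (I : LIdeal A) : Function.Surjective I.proj := Ideal.Quotient.mk_surjective

theorem proj_eq {a b : A} : I.proj a = I.proj b ↔ a - b ∈ I := Ideal.Quotient.eq

section

/-- Joins in the quotient, computed on representatives. -/
@[reducible] def quotMax (I : LIdeal A) : Max I.Quot where
  max := Quotient.map₂ (· ⊔ ·) (fun _ _ h1 _ _ h2 => by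
    have h1' := (Submodule.quotientRel_def _).1 h1
    have h2' := (Submodule.quotientRel_def _).1 h2
    exact (Submodule.quotientRel_def _).2 (sup_sub_sup_mem h1' h2'))

/-- Meets in the quotient, computed on representatives. -/
@[reducible] def quotMin (I : LIdeal A) : Min I.Quot where
  min := Quotient.map₂ (· ⊓ ·) (fun _ _ h1 _ _ h2 => by
    have h1' := (Submodule.quotientRel_def _).1 h1
    have h2' := (Submodule.quotientRel_def _).1 h2
    exact (Submodule.quotientRel_def _).2 (inf_sub_inf_mem h1' h2'))

attribute [local instance] quotMax quotMin

theorem proj_sup' (I : LIdeal A) (a b : A) : I.proj (a ⊔ b) = I.proj a ⊔ I.proj b := rfl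
theorem proj_inf' (I : LIdeal A) (a b : A) : I.proj (a ⊓ b) = I.proj a ⊓ I.proj b := rfl

/-- The lattice structure on the quotient: joins and meets are computed on representatives. -/
instance (I : LIdeal A) : Lattice I.Quot :=
  Lattice.mk'
    (by
      intro a b
      obtain ⟨a, rfl⟩ := I.proj_surjective a; obtain ⟨b, rfl⟩ := I.proj_surjective b
      rw [← proj_sup', ← proj_sup', sup_comm])
    (by
      intro a b c
      obtain ⟨a, rfl⟩ := I.proj_surjective a; obtain ⟨b, rfl⟩ := I.proj_surjective b
      obtain ⟨c, rfl⟩ := I.proj_surjective c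
      rw [← proj_sup', ← proj_sup', ← proj_sup', ← proj_sup', sup_assoc])
    (by
      intro a b
      obtain ⟨a, rfl⟩ := I.proj_surjective a; obtain ⟨b, rfl⟩ := I.proj_surjective b
      rw [← proj_inf', ← proj_inf', inf_comm])
    (by
      intro a b c
      obtain ⟨a, rfl⟩ := I.proj_surjective a; obtain ⟨b, rfl⟩ := I.proj_surjective b
      obtain ⟨c, rfl⟩ := I.proj_surjective c
      rw [← proj_inf', ← proj_inf', ← proj_inf', ← proj_inf', inf_assoc])
    (by
      intro a b
      obtain ⟨a, rfl⟩ := I.proj_surjective a; obtain ⟨b, rfl⟩ := I.proj_surjective b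
      rw [← proj_inf', ← proj_sup', sup_inf_self])
    (by
      intro a b
      obtain ⟨a, rfl⟩ := I.proj_surjective a; obtain ⟨b, rfl⟩ := I.proj_surjective b
      rw [← proj_sup', ← proj_inf', inf_sup_self])

end

theorem proj_sup (I : LIdeal A) (a b : A) : I.proj (a ⊔ b) = I.proj a ⊔ I.proj b := rfl
theorem proj_inf (I : LIdeal A) (a b : A) : I.proj (a ⊓ b) = I.proj a ⊓ I.proj b := rfl

theorem proj_le_iff {a b : A} : I.proj a ≤ I.proj b ↔ (a - b) ⊔ 0 ∈ I := by
  rw [← sup_eq_right, ← proj_sup, proj_eq]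
  have : a ⊔ b - b = (a - b) ⊔ 0 := by rw [← sub_self b, ← sup_sub]
  rw [this]

theorem proj_mono {a b : A} (h : a ≤ b) : I.proj a ≤ I.proj b := by
  rw [← sup_eq_right, ← proj_sup, sup_eq_right.2 h]

theorem exists_nonneg {x : I.Quot} (h : 0 ≤ x) : ∃ a : A, 0 ≤ a ∧ I.proj a = x := by
  obtain ⟨a, rfl⟩ := I.proj_surjective x
  refine ⟨a ⊔ 0, le_sup_right, ?_⟩
  rw [proj_sup, map_zero, sup_eq_left.2 h]

instance (I : LIdeal A) : IsLAlgebra I.Quot where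
  add_le_add' x y z h := by
    obtain ⟨a, rfl⟩ := I.proj_surjective x; obtain ⟨b, rfl⟩ := I.proj_surjective y
    obtain ⟨c, rfl⟩ := I.proj_surjective z
    rw [← map_add, ← map_add, proj_le_iff, add_sub_add_right_eq_sub]
    exact proj_le_iff.1 h
  mul_nonneg' x y hx hy := by
    obtain ⟨a, ha, rfl⟩ := exists_nonneg hx; obtain ⟨b, hb, rfl⟩ := exists_nonneg hy
    rw [← map_mul, ← map_zero I.proj]
    exact proj_mono (mul_nonneg ha hb)
  smul_nonneg' r x hr hx := by
    obtain ⟨a, ha, rfl⟩ := exists_nonneg hx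
    rw [← map_smul, ← map_zero I.proj]
    exact proj_mono (IsLAlgebra.smul_nonneg' r a hr ha)

theorem quot_bounded (I : LIdeal A) : IsBounded I.Quot := by
  intro x
  obtain ⟨a, rfl⟩ := I.proj_surjective x
  obtain ⟨n, hn⟩ := IsBAL.bounded a
  refine ⟨n, ?_⟩
  rw [← map_one I.proj, ← map_nsmul]
  exact proj_mono hn

/-- An `ℓ`-ideal is archimedean if its quotient is archimedean. -/
def IsArch (I : LIdeal A) : Prop := IsArchimedean I.Quot

theorem isArch_iff : I.IsArch ↔
    ∀ a b : A, (∀ n : ℕ, (n • a - b) ⊔ 0 ∈ I) → a ⊔ 0 ∈ I := by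
  constructor
  · intro h a b hab
    have := h (I.proj a) (I.proj b) fun n => by
      rw [← map_nsmul]; exact proj_le_iff.2 (hab n)
    rw [← map_zero I.proj, proj_le_iff, sub_zero] at this
    exact this
  · intro h x y hxy
    obtain ⟨a, rfl⟩ := I.proj_surjective x; obtain ⟨b, rfl⟩ := I.proj_surjective y
    rw [← map_zero I.proj, proj_le_iff, sub_zero]
    refine h a b fun n => proj_le_iff.1 ?_
    rw [map_nsmul]; exact hxy n

/-- The archimedean `ℓ`-ideal generated by a set: the intersection of all the archimedean
`ℓ`-ideals that contain it. -/
def archSpan (S : Set A) : LIdeal A := sInter {I | I.IsArch ∧ S ⊆ I}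

theorem archSpan_isArch (S : Set A) : (archSpan S).IsArch := by
  refine isArch_iff.2 fun a b h => mem_sInter.2 fun I hI => ?_
  exact isArch_iff.1 hI.1 a b fun n => mem_sInter.1 (h n) I hI

theorem subset_archSpan (S : Set A) : S ⊆ (archSpan S : Set A) :=
  fun _ ha => mem_sInter.2 fun _ hI => hI.2 ha

theorem archSpan_le {S : Set A} (h : I.IsArch) (hS : S ⊆ I) : archSpan S ≤ I :=
  fun _ ha => mem_sInter.1 ha I ⟨h, hS⟩

instance (S : Set A) : IsBAL (archSpan S).Quot where
  bounded := quot_bounded _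
  archimedean := archSpan_isArch S

/-- The kernel of a morphism into a bounded archimedean `ℓ`-algebra. -/
def ker {B : Type*} [CommRing B] [Lattice B] [Algebra ℝ B] [IsBAL B] (f : LAlgHom A B) :
    LIdeal A where
  toIdeal := RingHom.ker f
  solid _ b h hb := by
    rw [RingHom.mem_ker] at hb ⊢
    have := f.mono h
    rw [f.map_abs, f.map_abs, hb, abs_zero] at this
    exact le_antisymm ((le_abs_self _).trans this)
      (neg_nonpos.1 ((neg_le_abs _).trans this))

theorem mem_ker {B : Type*} [CommRing B] [Lattice B] [Algebra ℝ B] [IsBAL B] {f : LAlgHom A B}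
    {a : A} : a ∈ ker f ↔ f a = 0 := RingHom.mem_ker

theorem ker_isArch {B : Type*} [CommRing B] [Lattice B] [Algebra ℝ B] [IsBAL B]
    (f : LAlgHom A B) : (ker f).IsArch := by
  refine isArch_iff.2 fun a b h => ?_
  simp only [mem_ker, f.map_sup, map_zero, map_sub, map_nsmul, sup_eq_right, sub_nonpos] at h ⊢
  exact IsBAL.archimedean _ _ h

end

end LIdeal

namespace LIdeal

section
variable {A : Type u} [CommRing A] [Lattice A] [Algebra ℝ A] [IsBAL A]

/-- The quotient map as a morphism of `ℓ`-algebras. -/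
def projHom (I : LIdeal A) : LAlgHom A I.Quot where
  toAlgHom := I.proj
  map_sup' := I.proj_sup
  map_inf' := I.proj_inf

theorem projHom_surjective (I : LIdeal A) : Function.Surjective I.projHom := I.proj_surjective

/-- A morphism that vanishes on `I` factors through the quotient by `I`. -/
def quotLift {B : Type*} [CommRing B] [Lattice B] [Algebra ℝ B] (I : LIdeal A) (f : LAlgHom A B)
    (h : ∀ a ∈ I, f a = 0) : LAlgHom I.Quot B where
  toAlgHom := Ideal.Quotient.liftₐ I.toIdeal f.toAlgHom h
  map_sup' x y := by
    obtain ⟨a, rfl⟩ := I.proj_surjective x; obtain ⟨b, rfl⟩ := I.proj_surjective y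
    exact f.map_sup a b
  map_inf' x y := by
    obtain ⟨a, rfl⟩ := I.proj_surjective x; obtain ⟨b, rfl⟩ := I.proj_surjective y
    exact f.map_inf a b

theorem quotLift_projHom {B : Type*} [CommRing B] [Lattice B] [Algebra ℝ B] (I : LIdeal A)
    (f : LAlgHom A B) (h : ∀ a ∈ I, f a = 0) (a : A) : I.quotLift f h (I.projHom a) = f a := rfl

end

end LIdeal

/-! ## Free bounded archimedean `ℓ`-algebras over weighted sets -/

/-- Terms in the language of `ℓ`-algebras, with a constant for each real number. -/
inductive Term (X : Type u) : Type u
  | var (x : X) : Term X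
  | const (r : ℝ) : Term X
  | add (s t : Term X) : Term X
  | mul (s t : Term X) : Term X
  | neg (t : Term X) : Term X
  | sup (s t : Term X) : Term X
  | inf (s t : Term X) : Term X

/-- The value of a term under an assignment of the variables. -/
def Term.eval {X : Type u} {B : Type*} [CommRing B] [Lattice B] [Algebra ℝ B] (φ : X → B) :
    Term X → B
  | var x => φ x
  | const r => algebraMap ℝ B r
  | add s t => s.eval φ + t.eval φ
  | mul s t => s.eval φ * t.eval φ
  | neg t => -t.eval φ
  | sup s t => s.eval φ ⊔ t.eval φ
  | inf s t => s.eval φ ⊓ t.eval φ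

/-- `φ` is a morphism of weighted sets from `(X, w)` to `B` with its norm. -/
def IsWeighted {X : Type u} {B : Type*} [CommRing B] [Lattice B] [Algebra ℝ B] (w : X → ℝ)
    (φ : X → B) : Prop := ∀ x, norm (φ x) ≤ w x

/-- Two terms are identified if they have the same value under every morphism of weighted sets
from `(X, w)` to a bounded archimedean `ℓ`-algebra. -/
def termSetoid {X : Type u} (w : X → ℝ) : Setoid (Term X) where
  r s t := ∀ (B : BAL.{u}) (φ : X → B), IsWeighted w φ → s.eval φ = t.eval φ
  iseqv :=
    { refl := fun _ _ _ _ => rfl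
      symm := fun h B φ hφ => (h B φ hφ).symm
      trans := fun h k B φ hφ => (h B φ hφ).trans (k B φ hφ) }

/-- The carrier of the free bounded archimedean `ℓ`-algebra over the weighted set `(X, w)`. -/
def Free {X : Type u} (w : X → ℝ) : Type u := Quotient (termSetoid w)

namespace Free

variable {X : Type u} {w : X → ℝ}

/-- The class of a term. -/
def cls (t : Term X) : Free w := Quotient.mk (termSetoid w) t

/-- The value of an element under a morphism of weighted sets. -/
def ev (B : BAL.{u}) (φ : X → B) (hφ : IsWeighted w φ) : Free w → B :=
  Quotient.lift (fun t => t.eval φ) fun _ _ h => h B φ hφ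

theorem ev_ext {a b : Free w} (h : ∀ B φ hφ, ev B φ hφ a = ev B φ hφ b) : a = b := by
  induction a using Quotient.inductionOn
  induction b using Quotient.inductionOn
  exact Quotient.sound h

/-- The binary operation induced by an operation on terms. -/
def op₂ (f : Term X → Term X → Term X)
    (g : ∀ (B : BAL.{u}), B → B → B)
    (h : ∀ (B : BAL.{u}) (φ : X → B) s t, (f s t).eval φ = g B (s.eval φ) (t.eval φ)) :
    Free w → Free w → Free w :=
  Quotient.map₂ f fun _ _ h1 _ _ h2 B φ hφ => by rw [h, h, h1 B φ hφ, h2 B φ hφ]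

instance : Zero (Free w) := ⟨cls (.const 0)⟩
instance : One (Free w) := ⟨cls (.const 1)⟩
instance : Add (Free w) := ⟨op₂ .add (fun _ => (· + ·)) fun _ _ _ _ => rfl⟩
instance : Mul (Free w) := ⟨op₂ .mul (fun _ => (· * ·)) fun _ _ _ _ => rfl⟩
instance : Neg (Free w) :=
  ⟨Quotient.map .neg fun _ _ h B φ hφ => congrArg Neg.neg (h B φ hφ)⟩

section
variable (B : BAL.{u}) (φ : X → B) (hφ : IsWeighted w φ) (a b : Free w)

theorem ev_cls (t : Term X) : ev B φ hφ (cls t) = t.eval φ := rfl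
theorem ev_zero : ev B φ hφ 0 = 0 := (algebraMap ℝ B).map_zero
theorem ev_one : ev B φ hφ 1 = 1 := (algebraMap ℝ B).map_one
theorem ev_add : ev B φ hφ (a + b) = ev B φ hφ a + ev B φ hφ b := by
  induction a using Quotient.inductionOn; induction b using Quotient.inductionOn; rfl
theorem ev_mul : ev B φ hφ (a * b) = ev B φ hφ a * ev B φ hφ b := by
  induction a using Quotient.inductionOn; induction b using Quotient.inductionOn; rfl
theorem ev_neg : ev B φ hφ (-a) = -ev B φ hφ a := by
  induction a using Quotient.inductionOn; rfl
end

instance : CommRing (Free w) where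
  add_assoc a b c := ev_ext fun B φ hφ => by simp only [ev_add, add_assoc]
  zero_add a := ev_ext fun B φ hφ => by simp only [ev_add, ev_zero, zero_add]
  add_zero a := ev_ext fun B φ hφ => by simp only [ev_add, ev_zero, add_zero]
  add_comm a b := ev_ext fun B φ hφ => by simp only [ev_add, add_comm]
  neg_add_cancel a := ev_ext fun B φ hφ => by simp only [ev_add, ev_neg, ev_zero, neg_add_cancel]
  mul_assoc a b c := ev_ext fun B φ hφ => by simp only [ev_mul, mul_assoc]
  one_mul a := ev_ext fun B φ hφ => by simp only [ev_mul, ev_one, one_mul]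
  mul_one a := ev_ext fun B φ hφ => by simp only [ev_mul, ev_one, mul_one]
  mul_comm a b := ev_ext fun B φ hφ => by simp only [ev_mul, mul_comm]
  zero_mul a := ev_ext fun B φ hφ => by simp only [ev_mul, ev_zero, zero_mul]
  mul_zero a := ev_ext fun B φ hφ => by simp only [ev_mul, ev_zero, mul_zero]
  left_distrib a b c := ev_ext fun B φ hφ => by simp only [ev_add, ev_mul, mul_add]
  right_distrib a b c := ev_ext fun B φ hφ => by simp only [ev_add, ev_mul, add_mul]
  nsmul := nsmulRec
  zsmul := zsmulRec

instance : Algebra ℝ (Free w) :=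
  RingHom.toAlgebra
    { toFun := fun r => cls (.const r)
      map_zero' := rfl
      map_one' := rfl
      map_add' := fun r s => ev_ext fun B φ hφ => by
        rw [ev_add]; exact (algebraMap ℝ B).map_add r s
      map_mul' := fun r s => ev_ext fun B φ hφ => by
        rw [ev_mul]; exact (algebraMap ℝ B).map_mul r s }

section
/-- Joins of classes of terms. -/
@[reducible] def max : Max (Free w) := ⟨op₂ .sup (fun _ => (· ⊔ ·)) fun _ _ _ _ => rfl⟩
/-- Meets of classes of terms. -/
@[reducible] def min : Min (Free w) := ⟨op₂ .inf (fun _ => (· ⊓ ·)) fun _ _ _ _ => rfl⟩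

attribute [local instance] max min

theorem ev_sup' (B : BAL.{u}) (φ : X → B) (hφ : IsWeighted w φ) (a b : Free w) :
    ev B φ hφ (a ⊔ b) = ev B φ hφ a ⊔ ev B φ hφ b := by
  induction a using Quotient.inductionOn; induction b using Quotient.inductionOn; rfl
theorem ev_inf' (B : BAL.{u}) (φ : X → B) (hφ : IsWeighted w φ) (a b : Free w) :
    ev B φ hφ (a ⊓ b) = ev B φ hφ a ⊓ ev B φ hφ b := by
  induction a using Quotient.inductionOn; induction b using Quotient.inductionOn; rfl

instance : Lattice (Free w) :=
  Lattice.mk'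
    (fun a b => ev_ext fun B φ hφ => by simp only [ev_sup', sup_comm])
    (fun a b c => ev_ext fun B φ hφ => by simp only [ev_sup', sup_assoc])
    (fun a b => ev_ext fun B φ hφ => by simp only [ev_inf', inf_comm])
    (fun a b c => ev_ext fun B φ hφ => by simp only [ev_inf', inf_assoc])
    (fun a b => ev_ext fun B φ hφ => by simp only [ev_sup', ev_inf', sup_inf_self])
    (fun a b => ev_ext fun B φ hφ => by simp only [ev_sup', ev_inf', inf_sup_self])

end

/-- The value of an element under a morphism of weighted sets, as a morphism of
`ℓ`-algebras. -/
def evHom (B : BAL.{u}) (φ : X → B) (hφ : IsWeighted w φ) : LAlgHom (Free w) B where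
  toFun := ev B φ hφ
  map_zero' := ev_zero B φ hφ
  map_one' := ev_one B φ hφ
  map_add' := ev_add B φ hφ
  map_mul' := ev_mul B φ hφ
  commutes' _ := rfl
  map_sup' := ev_sup' B φ hφ
  map_inf' := ev_inf' B φ hφ

theorem evHom_ext {a b : Free w} (h : ∀ B φ hφ, evHom B φ hφ a = evHom B φ hφ b) : a = b :=
  ev_ext h

theorem le_of_evHom {a b : Free w} (h : ∀ B φ hφ, evHom B φ hφ a ≤ evHom B φ hφ b) : a ≤ b := by
  rw [← sup_eq_right]
  refine evHom_ext fun B φ hφ => ?_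
  rw [(evHom B φ hφ).map_sup, sup_eq_right.2 (h B φ hφ)]

instance : IsLAlgebra (Free w) where
  add_le_add' a b c h := le_of_evHom fun B φ hφ => by
    rw [map_add, map_add]; exact add_le_add_left ((evHom B φ hφ).mono h) _
  mul_nonneg' a b ha hb := le_of_evHom fun B φ hφ => by
    rw [map_zero, map_mul]
    have ha' := (evHom B φ hφ).mono ha
    have hb' := (evHom B φ hφ).mono hb
    rw [map_zero] at ha' hb'
    exact mul_nonneg ha' hb'
  smul_nonneg' r a hr ha := le_of_evHom fun B φ hφ => by
    rw [map_zero, map_smul]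
    have ha' := (evHom B φ hφ).mono ha
    rw [map_zero] at ha'
    exact IsLAlgebra.smul_nonneg' r _ hr ha'

theorem eval_bounded (w : X → ℝ) (t : Term X) :
    ∃ n : ℕ, ∀ (B : BAL.{u}) (φ : X → B), IsWeighted w φ → |t.eval φ| ≤ algebraMap ℝ B n := by
  induction t with
  | var x =>
    obtain ⟨n, hn⟩ := exists_nat_ge (w x)
    exact ⟨n, fun B φ hφ => (abs_le_norm (φ x)).trans (real_mono ((hφ x).trans hn))⟩
  | const r =>
    obtain ⟨n, hn⟩ := exists_nat_ge |r|
    exact ⟨n, fun B φ hφ => by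
      change |algebraMap ℝ B r| ≤ _
      rw [abs_real]; exact real_mono hn⟩
  | add s t hs ht =>
    obtain ⟨m, hm⟩ := hs; obtain ⟨n, hn⟩ := ht
    refine ⟨m + n, fun B φ hφ => (abs_add_le _ _).trans ?_⟩
    rw [Nat.cast_add, map_add]
    exact add_le_add (hm B φ hφ) (hn B φ hφ)
  | mul s t hs ht =>
    obtain ⟨m, hm⟩ := hs; obtain ⟨n, hn⟩ := ht
    refine ⟨3 * (m * n), fun B φ hφ => ?_⟩
    rw [Nat.cast_mul, Nat.cast_mul, map_mul, map_mul, map_natCast _ 3, Nat.cast_ofNat]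
    exact abs_mul_le_of_le (hm B φ hφ) (hn B φ hφ)
  | neg t ht =>
    obtain ⟨n, hn⟩ := ht
    exact ⟨n, fun B φ hφ => by
      change |-t.eval φ| ≤ _
      rw [abs_neg]; exact hn B φ hφ⟩
  | sup s t hs ht =>
    obtain ⟨m, hm⟩ := hs; obtain ⟨n, hn⟩ := ht
    refine ⟨m + n, fun B φ hφ => ?_⟩
    have h1 := hm B φ hφ
    have h2 := hn B φ hφ
    have h := abs_sup_sub_sup (s.eval φ) (t.eval φ) 0 0
    rw [sup_idem, sub_zero, sub_zero, sub_zero] at h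
    rw [Nat.cast_add, map_add]
    exact h.trans (add_le_add h1 h2)
  | inf s t hs ht =>
    obtain ⟨m, hm⟩ := hs; obtain ⟨n, hn⟩ := ht
    refine ⟨m + n, fun B φ hφ => ?_⟩
    have h1 := hm B φ hφ
    have h2 := hn B φ hφ
    have h := abs_inf_sub_inf (s.eval φ) (t.eval φ) 0 0
    rw [inf_idem, sub_zero, sub_zero, sub_zero] at h
    rw [Nat.cast_add, map_add]
    exact h.trans (add_le_add h1 h2)

instance : IsBAL (Free w) where
  bounded a := by
    induction a using Quotient.inductionOn with
    | h t =>
      obtain ⟨n, hn⟩ := eval_bounded w t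
      refine ⟨n, le_of_evHom fun B φ hφ => ?_⟩
      rw [map_nsmul, map_one, nsmul_one_eq_real]
      exact (le_abs_self _).trans (hn B φ hφ)
  archimedean a b h := le_of_evHom fun B φ hφ => by
    rw [map_zero]
    refine IsBAL.archimedean _ (evHom B φ hφ b) fun n => ?_
    rw [← map_nsmul]
    exact (evHom B φ hφ).mono (h n)

/-- The universal map from a weighted set to the free algebra over it. -/
def of (x : X) : Free w := cls (.var x)

theorem of_isWeighted (hw : ∀ x, 0 ≤ w x) : IsWeighted w (of : X → Free w) := fun x =>
  norm_le (hw x) <| le_of_evHom fun B φ hφ => by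
    rw [LAlgHom.map_abs, LAlgHom.map_real]
    exact (abs_le_norm (φ x)).trans (real_mono (hφ x))

theorem hom_ext {B : Type*} [CommRing B] [Lattice B] [Algebra ℝ B] {f g : LAlgHom (Free w) B}
    (h : ∀ x, f (of x) = g (of x)) : f = g := by
  refine LAlgHom.ext fun a => ?_
  induction a using Quotient.inductionOn with
  | h t =>
    change f (cls t) = g (cls t)
    induction t with
    | var x => exact h x
    | const r => exact (f.map_real r).trans (g.map_real r).symm
    | add s t hs ht =>
      change f (cls s + cls t) = g (cls s + cls t)
      rw [map_add, map_add, hs, ht]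
    | mul s t hs ht =>
      change f (cls s * cls t) = g (cls s * cls t)
      rw [map_mul, map_mul, hs, ht]
    | neg t ht =>
      change f (-cls t) = g (-cls t)
      rw [map_neg, map_neg, ht]
    | sup s t hs ht =>
      change f (cls s ⊔ cls t) = g (cls s ⊔ cls t)
      rw [f.map_sup, g.map_sup, hs, ht]
    | inf s t hs ht =>
      change f (cls s ⊓ cls t) = g (cls s ⊓ cls t)
      rw [f.map_inf, g.map_inf, hs, ht]

/-- The universal property: `Free w`, with the map `Free.of`, is the free bounded archimedean
`ℓ`-algebra over the weighted set `(X, w)`. -/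
theorem existsUnique_lift (B : BAL.{u}) (φ : X → B) (hφ : IsWeighted w φ) :
    ∃! f : LAlgHom (Free w) B, ∀ x, f (of x) = φ x :=
  ⟨evHom B φ hφ, fun _ => rfl, fun _ hg => hom_ext hg⟩

end Free

/-! ## The endofunctor `H` -/

section HFunctor

variable (A : Type u) [CommRing A] [Lattice A] [Algebra ℝ A]

/-- The weight function `w_A(a) = max {‖a‖, 1}`. -/
noncomputable def weight (a : A) : ℝ := max (norm a) 1

/-- The relations imposed on the free algebra over `(A, w_A)`. -/
def relations : Set (Free (weight A)) :=
  {x | ∃ a b : A, x = Free.of (a ⊓ b) - Free.of a ⊓ Free.of b} ∪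
  {x | ∃ r : ℝ, x = Free.of (algebraMap ℝ A r) - algebraMap ℝ _ r
      - (1 - algebraMap ℝ _ r) * Free.of 0} ∪
  {x | ∃ a : A, x = Free.of (a ⊔ 0) - Free.of a ⊔ 0} ∪
  {x | ∃ (a : A) (r : ℝ), x = Free.of (a + algebraMap ℝ A r) - Free.of a
      - Free.of (algebraMap ℝ A r) + Free.of 0} ∪
  {x | ∃ (a : A) (r : ℝ), 0 ≤ r ∧ x = Free.of (r • a) - Free.of (algebraMap ℝ A r) * Free.of a}

/-- The quotient of the free algebra over `(A, w_A)` by the archimedean `ℓ`-ideal generated by the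
relations. -/
def HObj : Type u := (LIdeal.archSpan (relations A)).Quot

noncomputable instance : CommRing (HObj A) :=
  inferInstanceAs (CommRing (LIdeal.archSpan (relations A)).Quot)
noncomputable instance : Lattice (HObj A) :=
  inferInstanceAs (Lattice (LIdeal.archSpan (relations A)).Quot)
noncomputable instance : Algebra ℝ (HObj A) :=
  inferInstanceAs (Algebra ℝ (LIdeal.archSpan (relations A)).Quot)
instance : IsBAL (HObj A) :=
  inferInstanceAs (IsBAL (LIdeal.archSpan (relations A)).Quot)

variable {A}

/-- The quotient map from the free algebra. -/
noncomputable def HObj.quot : LAlgHom (Free (weight A)) (HObj A) :=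
  LIdeal.projHom (LIdeal.archSpan (relations A))

/-- The element `□_a` of `H(A)`. -/
noncomputable def box (a : A) : HObj A := HObj.quot (Free.of a)

theorem HObj.quot_eq_zero {x : Free (weight A)} (h : x ∈ relations A) : HObj.quot x = 0 := by
  have h1 : x - 0 ∈ LIdeal.archSpan (relations A) := by
    rw [sub_zero]; exact LIdeal.subset_archSpan _ h
  exact (LIdeal.proj_eq.2 h1).trans (map_zero HObj.quot)

theorem box_inf (a b : A) : box (a ⊓ b) = box a ⊓ box b := by
  have := HObj.quot_eq_zero (A := A)
    (Or.inl (Or.inl (Or.inl (Or.inl ⟨a, b, rfl⟩))))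
  rwa [map_sub, LAlgHom.map_inf, sub_eq_zero] at this

theorem box_real (r : ℝ) : box (algebraMap ℝ A r) =
    algebraMap ℝ _ r + (1 - algebraMap ℝ _ r) * box (0 : A) := by
  have := HObj.quot_eq_zero (A := A) (Or.inl (Or.inl (Or.inl (Or.inr ⟨r, rfl⟩))))
  rwa [map_sub, map_sub, map_mul, map_sub, map_one, LAlgHom.map_real, sub_sub, sub_eq_zero] at this

theorem box_pos (a : A) : box (a ⊔ 0) = box a ⊔ 0 := by
  have := HObj.quot_eq_zero (A := A) (Or.inl (Or.inl (Or.inr ⟨a, rfl⟩)))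
  rwa [map_sub, LAlgHom.map_sup, map_zero, sub_eq_zero] at this

theorem box_add_real (a : A) (r : ℝ) :
    box (a + algebraMap ℝ A r) = box a + box (algebraMap ℝ A r) - box 0 := by
  have := HObj.quot_eq_zero (A := A) (Or.inl (Or.inr ⟨a, r, rfl⟩))
  rw [map_add, map_sub, map_sub] at this
  change box _ - box a - box _ + box 0 = 0 at this
  rw [← sub_eq_zero, ← this]; ring

theorem box_smul (a : A) {r : ℝ} (hr : 0 ≤ r) :
    box (r • a) = box (algebraMap ℝ A r) * box a := by
  have := HObj.quot_eq_zero (A := A) (Or.inr ⟨a, r, hr, rfl⟩)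
  rwa [map_sub, map_mul, sub_eq_zero] at this

theorem box_isWeighted : IsWeighted (weight A) (box : A → HObj A) := fun a =>
  (norm_map_le HObj.quot (Free.of a)).trans
    (Free.of_isWeighted (fun _ => le_max_of_le_right zero_le_one) a)

/-- A morphism on `H(A)` is determined by its values on the elements `□_a`. -/
theorem HObj.hom_ext {B : Type*} [CommRing B] [Lattice B] [Algebra ℝ B] {f g : LAlgHom (HObj A) B}
    (h : ∀ a, f (box a) = g (box a)) : f = g := by
  have h1 : f.comp HObj.quot = g.comp HObj.quot := Free.hom_ext h
  refine LAlgHom.ext fun x => ?_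
  obtain ⟨y, rfl⟩ := LIdeal.projHom_surjective _ x
  exact DFunLike.congr_fun h1 y

/-- `□` satisfies the axioms that are imposed on the generators of `H(A)`. -/
structure IsModal {B : Type*} [CommRing B] [Lattice B] [Algebra ℝ B] (p : A → B) : Prop where
  inf : ∀ a b, p (a ⊓ b) = p a ⊓ p b
  real : ∀ r : ℝ, p (algebraMap ℝ A r) = algebraMap ℝ B r + (1 - algebraMap ℝ B r) * p 0
  pos : ∀ a, p (a ⊔ 0) = p a ⊔ 0
  add_real : ∀ (a : A) (r : ℝ), p (a + algebraMap ℝ A r) = p a + p (algebraMap ℝ A r) - p 0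
  smul : ∀ (a : A) (r : ℝ), 0 ≤ r → p (r • a) = p (algebraMap ℝ A r) * p a

theorem box_isModal : IsModal (box : A → HObj A) :=
  ⟨box_inf, box_real, box_pos, box_add_real, fun a _ hr => box_smul a hr⟩

/-- The universal property of `H(A)`: extension of maps that satisfy the relations. -/
noncomputable def HObj.lift (B : BAL.{u}) (p : A → B) (hw : IsWeighted (weight A) p) (hp : IsModal p) :
    LAlgHom (HObj A) B :=
  LIdeal.quotLift _ (Free.evHom B p hw) fun x hx => by
    refine LIdeal.mem_ker.1 (LIdeal.archSpan_le (LIdeal.ker_isArch _) ?_ hx)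
    have ev : ∀ a : A, Free.evHom B p hw (Free.of a) = p a := fun _ => rfl
    rintro _ ((((⟨a, b, rfl⟩ | ⟨r, rfl⟩) | ⟨a, rfl⟩) | ⟨a, r, rfl⟩) | ⟨a, r, hr, rfl⟩) <;>
      refine LIdeal.mem_ker.2 ?_
    · rw [map_sub, LAlgHom.map_inf, ev, ev, ev, hp.inf, sub_self]
    · rw [map_sub, map_sub, map_mul, map_sub, map_one, LAlgHom.map_real, ev, ev, hp.real]; ring
    · rw [map_sub, LAlgHom.map_sup, map_zero, ev, ev, hp.pos, sub_self]
    · rw [map_add, map_sub, map_sub, ev, ev, ev, ev, hp.add_real]; ring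
    · rw [map_sub, map_mul, ev, ev, ev, hp.smul a r hr, sub_self]

theorem HObj.lift_box (B : BAL.{u}) (p : A → B) (hw : IsWeighted (weight A) p) (hp : IsModal p)
    (a : A) : HObj.lift B p hw hp (box a) = p a := rfl

theorem weight_map_le [IsBAL A] {B : Type*} [CommRing B] [Lattice B] [Algebra ℝ B]
    (f : LAlgHom A B) (a : A) : weight B (f a) ≤ weight A a :=
  max_le_max (norm_map_le f a) le_rfl

theorem IsModal.comp_hom {A' : Type*} [CommRing A'] [Lattice A'] [Algebra ℝ A'] {B : Type*}
    [CommRing B] [Lattice B] [Algebra ℝ B] {p : A' → B} (hp : IsModal p) (f : LAlgHom A A') :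
    IsModal fun a => p (f a) where
  inf a b := by simp only [f.map_inf, hp.inf]
  real r := by simp only [f.map_real, map_zero, hp.real r]
  pos a := by simp only [f.map_sup, map_zero, hp.pos]
  add_real a r := by simp only [map_add, f.map_real, map_zero, hp.add_real]
  smul a r hr := by simp only [map_smul, f.map_real, hp.smul _ r hr]

end HFunctor

/-- The object `H(A)`. -/
noncomputable def BAL.H (A : BAL.{u}) : BAL.{u} := { carrier := HObj A }

/-- The morphism `H(f)`: the unique morphism sending `□_a` to `□_{f(a)}`. -/
noncomputable def BAL.HMap {A B : BAL.{u}} (f : LAlgHom A B) : LAlgHom (HObj A) (HObj B) :=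
  HObj.lift (BAL.H B) (fun a => box (f a))
    (fun a => (box_isWeighted (f a)).trans (weight_map_le f a)) (box_isModal.comp_hom f)

theorem BAL.HMap_box {A B : BAL.{u}} (f : LAlgHom A B) (a : A) :
    BAL.HMap f (box a) = box (f a) := rfl

/-- The endofunctor `H` of the category of bounded archimedean `ℓ`-algebras. -/
noncomputable def H : BAL.{u} ⥤ BAL.{u} where
  obj A := A.H
  map f := BAL.ofHom (BAL.HMap (BAL.toHom f))
  map_id _ := HObj.hom_ext fun _ => rfl
  map_comp _ _ := HObj.hom_ext fun _ => rfl

/-! ## Maximal `ℓ`-ideals -/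

namespace LIdeal

section
variable {A : Type u} [CommRing A] [Lattice A] [Algebra ℝ A] [IsBAL A] {M : LIdeal A}

theorem one_mem_of_real_mem {I : LIdeal A} {r : ℝ} (hr : r ≠ 0) (h : algebraMap ℝ A r ∈ I) :
    (1 : A) ∈ I := by
  have := I.mul_mem_left (algebraMap ℝ A r⁻¹) h
  rwa [← map_mul, inv_mul_cancel₀ hr, map_one] at this

theorem mul_mem_right (I : LIdeal A) (b : A) {a : A} (h : a ∈ I) : a * b ∈ I := by
  rw [mul_comm]; exact I.mul_mem_left b h

/-- The `ℓ`-ideal generated by `I` and `x`, for `0 ≤ x`. -/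
def adjoin (I : LIdeal A) (x : A) : LIdeal A where
  toIdeal :=
    { carrier := {y | ∃ m ∈ I, 0 ≤ m ∧ ∃ n : ℕ, |y| ≤ m + n • x}
      zero_mem' := ⟨0, zero_mem I, le_rfl, 0, by simp⟩
      add_mem' := by
        rintro y z ⟨m, hm, hm0, n, hy⟩ ⟨m', hm', hm0', n', hz⟩
        refine ⟨m + m', add_mem hm hm', add_nonneg hm0 hm0', n + n', (abs_add_le _ _).trans ?_⟩
        rw [add_nsmul, add_add_add_comm]
        exact add_le_add hy hz
      smul_mem' := by
        rintro c y ⟨m, hm, hm0, n, hy⟩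
        obtain ⟨k, -, hk⟩ := exists_abs_le c
        refine ⟨(3 * k : ℕ) • m, nsmul_mem hm _, nsmul_nonneg hm0 _, 3 * k * n, ?_⟩
        refine (abs_mul_le_of_le hk hy).trans (le_of_eq ?_)
        simp only [nsmul_eq_mul]
        push_cast
        ring }
  solid a b h := by
    rintro ⟨m, hm, hm0, n, hb⟩
    exact ⟨m, hm, hm0, n, h.trans hb⟩

theorem mem_adjoin {I : LIdeal A} {x y : A} :
    y ∈ I.adjoin x ↔ ∃ m ∈ I, 0 ≤ m ∧ ∃ n : ℕ, |y| ≤ m + n • x := Iff.rfl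

theorem IsMaximal.exists_one_le (hM : M.IsMaximal) {x : A} (hx : 0 ≤ x) (h : x ∉ M) :
    ∃ m ∈ M, 0 ≤ m ∧ ∃ n : ℕ, 1 ≤ m + n • x := by
  by_contra hne
  have h1 : (1 : A) ∉ M.adjoin x := fun ⟨m, hm, hm0, n, hn⟩ =>
    hne ⟨m, hm, hm0, n, (le_abs_self _).trans hn⟩
  have hle : M ≤ M.adjoin x := fun a ha => ⟨|a|, abs_mem.2 ha, abs_nonneg a, 0, by simp⟩
  have := hM.2 _ hle h1
  refine h (this ▸ ?_)
  exact ⟨0, zero_mem M, le_rfl, 1, by simp [abs_of_nonneg hx]⟩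

theorem IsMaximal.mem_of_inf_eq_zero (hM : M.IsMaximal) {x y : A} (hx : 0 ≤ x) (hy : 0 ≤ y)
    (hxy : x ⊓ y = 0) (h : x ∉ M) : y ∈ M := by
  obtain ⟨m, hm, hm0, n, hn⟩ := hM.exists_one_le hx h
  have h1 : y ⊓ 1 ≤ m := by
    have a1 : y ⊓ 1 ≤ y ⊓ (m + n • x) := inf_le_inf_left _ hn
    have a2 := inf_add_le hy hm0 (nsmul_nonneg hx n)
    have a3 := inf_nsmul_le hy hx n
    rw [inf_comm y x, hxy, nsmul_zero] at a3
    calc y ⊓ 1 ≤ y ⊓ m + y ⊓ n • x := a1.trans a2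
      _ ≤ m + 0 := add_le_add inf_le_right a3
      _ = m := add_zero m
  have h2 : y ⊓ 1 ∈ M := mem_of_nonneg_of_le (le_inf hy zero_le_one) h1 hm
  obtain ⟨k, -, hk⟩ := exists_abs_le y
  have h3 := inf_nsmul_le hy zero_le_one k
  rw [inf_eq_left.2 ((le_abs_self y).trans hk)] at h3
  exact mem_of_nonneg_of_le hy h3 (nsmul_mem h2 k)

theorem IsMaximal.exists_real (hM : M.IsMaximal) (a : A) : ∃ r : ℝ, a - algebraMap ℝ A r ∈ M := by
  obtain ⟨k, -, hk⟩ := exists_abs_le a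
  rw [nsmul_one_eq_real] at hk
  set S : Set ℝ := {r | (a - algebraMap ℝ A r) ⊔ 0 ∈ M} with hS
  have hne : S.Nonempty := ⟨k, by
    change (a - algebraMap ℝ A k) ⊔ 0 ∈ M
    rw [sup_eq_right.2 (sub_nonpos.2 ((le_abs_self a).trans hk))]
    exact zero_mem M⟩
  have hbd : BddBelow S := by
    refine ⟨-k - 1, fun r hr => ?_⟩
    by_contra hlt
    rw [not_le] at hlt
    refine hM.1 (mem_of_nonneg_of_le zero_le_one ?_ hr)
    refine le_sup_of_le_left ?_
    have h1 : algebraMap ℝ A r ≤ algebraMap ℝ A (-k - 1) := real_mono hlt.le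
    rw [map_sub, map_neg, map_one] at h1
    have h2 := neg_of_abs_le hk
    rw [le_sub_iff_add_le]
    refine le_trans (add_le_add_right h1 _) (le_trans (le_of_eq ?_) h2)
    ring
  have hup : ∀ r s, r ∈ S → r ≤ s → s ∈ S := fun r s hr hrs =>
    mem_of_nonneg_of_le le_sup_right
      (sup_le_sup_right (sub_le_sub_left (real_mono hrs) a) 0) hr
  set r₀ := sInf S
  refine ⟨r₀, abs_mem.1 ?_⟩
  set c := |a - algebraMap ℝ A r₀|
  have hc : ∀ ε : ℝ, 0 < ε → ∃ m ∈ M, 0 ≤ m ∧ c ≤ m + algebraMap ℝ A ε := by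
    intro ε hε
    have h1 : r₀ + ε ∈ S := by
      obtain ⟨r, hr, hlt⟩ := exists_lt_of_csInf_lt hne (lt_add_of_pos_right r₀ hε)
      exact hup r _ hr hlt.le
    have h2 : (a - algebraMap ℝ A (r₀ - ε)) ⊔ 0 ∉ M := fun h =>
      absurd (csInf_le hbd h) (not_le.2 (sub_lt_self r₀ hε))
    have h3 : -(a - algebraMap ℝ A (r₀ - ε)) ⊔ 0 ∈ M :=
      hM.mem_of_inf_eq_zero le_sup_right le_sup_right
        (posPart_inf_negPart_eq_zero (a - algebraMap ℝ A (r₀ - ε))) h2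
    refine ⟨_, add_mem h1 h3, add_nonneg le_sup_right le_sup_right, sup_le ?_ ?_⟩
    · rw [← sub_le_iff_le_add]
      refine le_trans ?_ (le_add_of_nonneg_right le_sup_right)
      refine le_sup_of_le_left (le_of_eq ?_)
      rw [map_add]; ring
    · rw [← sub_le_iff_le_add]
      refine le_trans ?_ (le_add_of_nonneg_left le_sup_right)
      refine le_sup_of_le_left (le_of_eq ?_)
      rw [map_sub]; ring
  by_contra hcM
  obtain ⟨m, hm, hm0, n, hn⟩ := hM.exists_one_le (abs_nonneg _) hcM
  obtain ⟨m', hm', hm0', hm'c⟩ := hc (1 / (2 * (n + 1))) (by positivity)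
  have hε : (n : ℝ) * (1 / (2 * (n + 1))) ≤ 1 / 2 := by
    rw [mul_one_div, div_le_div_iff₀ (by positivity) (by norm_num)]
    linarith
  have h4 : n • c ≤ n • m' + algebraMap ℝ A (1 / 2) := by
    refine (nsmul_le_nsmul_right hm'c n).trans ?_
    rw [nsmul_add]
    refine add_le_add_right ?_ _
    rw [nsmul_eq_mul, ← map_natCast (algebraMap ℝ A), ← map_mul]
    exact real_mono hε
  have h5 : (1 : A) ≤ m + (n • m' + algebraMap ℝ A (1 / 2)) := hn.trans (add_le_add_right h4 m)
  have h6 : algebraMap ℝ A (1 / 2) ≤ m + n • m' := by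
    have e : algebraMap ℝ A (1 / 2) = 1 - algebraMap ℝ A (1 / 2) := by
      rw [← map_one (algebraMap ℝ A), ← map_sub]; norm_num
    rw [e, sub_le_iff_le_add, add_assoc]
    exact h5
  exact hM.1 (one_mem_of_real_mem (by norm_num)
    (mem_of_nonneg_of_le (real_nonneg (by norm_num)) h6 (add_mem hm (nsmul_mem hm' n))))

end

end LIdeal

/-! ## The Yosida space -/

/-- The Yosida space of `A`: the space of maximal `ℓ`-ideals of `A`. -/
def Yosida (A : Type u) [CommRing A] [Lattice A] : Type u := {M : LIdeal A // M.IsMaximal}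

namespace Yosida

section
variable {A : Type u} [CommRing A] [Lattice A] [Algebra ℝ A] [IsBAL A]

/-- The real number `r` with `a + M = r + M`. -/
noncomputable def val (M : Yosida A) (a : A) : ℝ := (M.2.exists_real a).choose

theorem sub_val_mem (M : Yosida A) (a : A) : a - algebraMap ℝ A (M.val a) ∈ M.1 :=
  (M.2.exists_real a).choose_spec

theorem val_eq {M : Yosida A} {a : A} {r : ℝ} (h : a - algebraMap ℝ A r ∈ M.1) : M.val a = r := by
  by_contra hne
  have h1 := sub_mem h (M.sub_val_mem a)
  rw [sub_sub_sub_cancel_left, ← map_sub] at h1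
  exact M.2.1 (LIdeal.one_mem_of_real_mem (sub_ne_zero.2 hne) h1)

/-- The morphism to the real numbers given by a maximal `ℓ`-ideal. -/
noncomputable def valHom (M : Yosida A) : LAlgHom A ℝ where
  toFun := M.val
  map_zero' := val_eq (by rw [map_zero, sub_zero]; exact zero_mem _)
  map_one' := val_eq (by rw [map_one, sub_self]; exact zero_mem _)
  map_add' a b := val_eq (by
    rw [map_add, add_sub_add_comm]
    exact add_mem (M.sub_val_mem a) (M.sub_val_mem b))
  map_mul' a b := val_eq (by
    have : a * b - algebraMap ℝ A (M.val a * M.val b) = a * (b - algebraMap ℝ A (M.val b)) +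
        (a - algebraMap ℝ A (M.val a)) * algebraMap ℝ A (M.val b) := by rw [map_mul]; ring
    rw [this]
    exact add_mem (M.1.mul_mem_left _ (M.sub_val_mem b))
      (M.1.mul_mem_right _ (M.sub_val_mem a)))
  commutes' r := val_eq (by rw [Algebra.algebraMap_self_apply, sub_self]; exact zero_mem _)
  map_sup' a b := val_eq (by
    rw [real_sup]; exact LIdeal.sup_sub_sup_mem (M.sub_val_mem a) (M.sub_val_mem b))
  map_inf' a b := val_eq (by
    rw [real_inf]; exact LIdeal.inf_sub_inf_mem (M.sub_val_mem a) (M.sub_val_mem b))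

theorem valHom_apply (M : Yosida A) (a : A) : M.valHom a = M.val a := rfl

theorem val_eq_zero {M : Yosida A} {a : A} : M.val a = 0 ↔ a ∈ M.1 := by
  refine ⟨fun h => ?_, fun h => val_eq (by rwa [map_zero, sub_zero])⟩
  have := M.sub_val_mem a
  rwa [h, map_zero, sub_zero] at this

theorem ext {M N : Yosida A} (h : ∀ a, M.val a = N.val a) : M = N := by
  refine Subtype.ext (SetLike.ext fun a => ?_)
  rw [← val_eq_zero, ← val_eq_zero, h]

end

instance : IsBAL ℝ where
  add_le_add' _ _ _ h := add_le_add_left h _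
  mul_nonneg' _ _ := mul_nonneg
  smul_nonneg' _ _ := smul_nonneg
  bounded a := by
    obtain ⟨n, hn⟩ := exists_nat_ge a
    exact ⟨n, by simpa using hn⟩
  archimedean a b h := by
    by_contra ha
    obtain ⟨n, hn⟩ := Archimedean.arch (b + 1) (not_le.1 ha)
    linarith [h n]

section
variable {A : Type u} [CommRing A] [Lattice A] [Algebra ℝ A] [IsBAL A]

/-- The kernel of a morphism to the real numbers is a maximal `ℓ`-ideal. -/
def ofHom (f : LAlgHom A ℝ) : Yosida A := ⟨LIdeal.ker f, by
  refine ⟨fun h => one_ne_zero ((map_one f).symm.trans (LIdeal.mem_ker.1 h)), fun J hJ h1 => ?_⟩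
  refine le_antisymm (fun a ha => LIdeal.mem_ker.2 ?_) hJ
  by_contra hne
  have h2 : a - algebraMap ℝ A (f a) ∈ LIdeal.ker f :=
    LIdeal.mem_ker.2 (by rw [map_sub, f.map_real]; exact sub_self _)
  have h3 := sub_mem ha (hJ h2)
  rw [sub_sub_cancel] at h3
  exact h1 (LIdeal.one_mem_of_real_mem hne h3)⟩

theorem ofHom_val (f : LAlgHom A ℝ) (a : A) : (ofHom f).val a = f a :=
  val_eq (LIdeal.mem_ker.2 (by rw [map_sub, f.map_real]; exact sub_self _))

theorem mem_ofHom {f : LAlgHom A ℝ} {a : A} : a ∈ (ofHom f).1 ↔ f a = 0 := LIdeal.mem_ker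

/-- The set `Z(I)` of maximal `ℓ`-ideals that contain `I`. -/
def zeroSet (I : LIdeal A) : Set (Yosida A) := {M | I ≤ M.1}

theorem mem_zeroSet {I : LIdeal A} {M : Yosida A} : M ∈ zeroSet I ↔ ∀ a ∈ I, M.val a = 0 :=
  ⟨fun h _ ha => val_eq_zero.2 (h ha), fun h a ha => val_eq_zero.1 (h a ha)⟩

theorem mem_zeroSet_span {S : Set A} {M : Yosida A} :
    M ∈ zeroSet (LIdeal.span S) ↔ ∀ a ∈ S, M.val a = 0 :=
  LIdeal.span_le.trans ⟨fun h _ ha => val_eq_zero.2 (h ha), fun h _ ha => val_eq_zero.1 (h _ ha)⟩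

/-- The topology of the Yosida space: the closed sets are exactly the sets `Z(I)`. -/
instance : TopologicalSpace (Yosida A) :=
  TopologicalSpace.ofClosed (Set.range zeroSet)
    ⟨LIdeal.span {1}, Set.eq_empty_of_forall_notMem fun M hM =>
      M.2.1 (hM (LIdeal.span_le.1 le_rfl rfl))⟩
    (by
      intro T hT
      refine ⟨LIdeal.span {a | ∃ I, zeroSet I ∈ T ∧ a ∈ I}, Set.ext fun M => ?_⟩
      rw [mem_zeroSet_span]
      constructor
      · intro h Z hZ
        obtain ⟨I, rfl⟩ := hT hZ
        exact mem_zeroSet.2 fun a ha => h a ⟨I, hZ, ha⟩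
      · rintro h a ⟨I, hI, ha⟩
        exact mem_zeroSet.1 (h _ hI) a ha)
    (by
      rintro _ ⟨I, rfl⟩ _ ⟨J, rfl⟩
      refine ⟨LIdeal.sInter {I, J}, Set.ext fun M => ?_⟩
      simp only [mem_zeroSet, LIdeal.mem_sInter, Set.mem_union, Set.mem_insert_iff,
        Set.mem_singleton_iff, forall_eq_or_imp, forall_eq]
      constructor
      · intro h
        by_contra hcon
        simp only [not_or, not_forall] at hcon
        obtain ⟨⟨a, ha, ha0⟩, b, hb, hb0⟩ := hcon
        refine mul_ne_zero ha0 hb0 ((map_mul M.valHom a b).symm.trans ?_)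
        exact h _ ⟨I.mul_mem_right _ ha, J.mul_mem_left _ hb⟩
      · rintro (h | h) a ⟨ha, hb⟩
        exacts [h a ha, h a hb])

theorem isClosed_iff {Z : Set (Yosida A)} : IsClosed Z ↔ ∃ I : LIdeal A, Z = zeroSet I := by
  have : IsClosed Z ↔ Z ∈ Set.range (zeroSet (A := A)) := by
    rw [← isOpen_compl_iff]
    change Zᶜᶜ ∈ _ ↔ _
    rw [compl_compl]
  rw [this]
  exact ⟨fun ⟨I, h⟩ => ⟨I, h.symm⟩, fun ⟨I, h⟩ => ⟨I, h.symm⟩⟩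

theorem isClosed_val_le (a : A) (r : ℝ) : IsClosed {M : Yosida A | M.val a ≤ r} := by
  refine isClosed_iff.2 ⟨LIdeal.span {(a - algebraMap ℝ A r) ⊔ 0}, Set.ext fun M => ?_⟩
  simp only [mem_zeroSet_span, Set.mem_singleton_iff, forall_eq, ← valHom_apply, LAlgHom.map_sup,
    map_sub, LAlgHom.map_real, map_zero, sup_eq_right, sub_nonpos, Algebra.algebraMap_self_apply,
    Set.mem_ofPred_eq]

theorem continuous_val (a : A) : Continuous fun M : Yosida A => M.val a := by
  refine OrderTopology.continuous_iff.2 fun r => ⟨?_, ?_⟩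
  · have := (isClosed_val_le a r).isOpen_compl
    convert this using 1
    ext M; simp
  · have := (isClosed_val_le (-a) (-r)).isOpen_compl
    convert this using 1
    ext M
    simp [← valHom_apply]

theorem val_mem_Icc (M : Yosida A) (a : A) : M.val a ∈ Set.Icc (-norm a) (norm a) := by
  have h := M.valHom.mono (abs_le_norm a)
  rw [LAlgHom.map_abs, LAlgHom.map_real] at h
  exact _root_.abs_le.1 h

theorem isInducing_val : Topology.IsInducing fun (M : Yosida A) (a : A) => M.val a := by
  refine Topology.isInducing_iff _ |>.2 (le_antisymm ?_ ?_)
  · exact continuous_iff_le_induced.1 (continuous_pi continuous_val)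
  · refine TopologicalSpace.le_def.2 fun U hU => ?_
    obtain ⟨I, hI⟩ := isClosed_iff.1 (isOpen_compl_iff.1 (by rwa [compl_compl] : IsOpen Uᶜᶜ))
    refine isOpen_induced_iff.2 ⟨{f | ∀ a ∈ I, f a = 0}ᶜ, ?_, ?_⟩
    · refine IsClosed.isOpen_compl (self := ?_)
      simp only [Set.ofPred_forall]
      exact isClosed_biInter fun a _ => isClosed_eq (continuous_apply a) continuous_const
    · rw [← compl_compl U, hI, Set.preimage_compl]
      congr 1
      ext M
      exact mem_zeroSet.symm

theorem isClosed_range_val : IsClosed (Set.range fun (M : Yosida A) (a : A) => M.val a) := by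
  have : (Set.range fun (M : Yosida A) (a : A) => M.val a) =
      {f : A → ℝ | (∀ a b, f (a + b) = f a + f b) ∧ (∀ a b, f (a * b) = f a * f b) ∧
        (∀ r : ℝ, f (algebraMap ℝ A r) = r) ∧ (∀ a b, f (a ⊔ b) = f a ⊔ f b) ∧
        (∀ a b, f (a ⊓ b) = f a ⊓ f b)} := by
    ext f
    constructor
    · rintro ⟨M, rfl⟩
      exact ⟨map_add M.valHom, map_mul M.valHom, M.valHom.map_real, M.valHom.map_sup,
        M.valHom.map_inf⟩
    · rintro ⟨h1, h2, h3, h4, h5⟩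
      let F : LAlgHom A ℝ :=
        { toFun := f
          map_zero' := by simpa using h3 0
          map_one' := by simpa using h3 1
          map_add' := h1
          map_mul' := h2
          commutes' := h3
          map_sup' := h4
          map_inf' := h5 }
      exact ⟨ofHom F, funext fun a => ofHom_val F a⟩
  rw [this]
  simp only [Set.ofPred_and, Set.ofPred_forall]
  refine IsClosed.inter ?_ (IsClosed.inter ?_ (IsClosed.inter ?_ (IsClosed.inter ?_ ?_)))
  · exact isClosed_iInter fun a => isClosed_iInter fun b => isClosed_eq (by fun_prop) (by fun_prop)
  · exact isClosed_iInter fun a => isClosed_iInter fun b => isClosed_eq (by fun_prop) (by fun_prop)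
  · exact isClosed_iInter fun a => isClosed_eq (by fun_prop) (by fun_prop)
  · exact isClosed_iInter fun a => isClosed_iInter fun b => isClosed_eq (by fun_prop) (by fun_prop)
  · exact isClosed_iInter fun a => isClosed_iInter fun b => isClosed_eq (by fun_prop) (by fun_prop)

instance : CompactSpace (Yosida A) := by
  refine ⟨isInducing_val.isCompact_iff.2 ?_⟩
  rw [Set.image_univ]
  refine (isCompact_univ_pi fun a : A => isCompact_Icc (a := -norm a) (b := norm a)).of_isClosed_subset
    isClosed_range_val ?_
  rintro _ ⟨M, rfl⟩ a -
  exact M.val_mem_Icc a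

instance : T2Space (Yosida A) :=
  T2Space.of_injective_continuous (f := fun (M : Yosida A) (a : A) => M.val a)
    (fun _ _ h => ext (congrFun h)) (continuous_pi continuous_val)

variable {B : Type u} [CommRing B] [Lattice B] [Algebra ℝ B] [IsBAL B]

/-- The preimage of a maximal `ℓ`-ideal under a morphism. -/
def comap (f : LAlgHom A B) (M : Yosida B) : Yosida A :=
  ⟨{ toIdeal := M.1.toIdeal.comap f
     solid := fun a b h hb => M.1.mem_of_abs_le
      (by rw [← f.map_abs, ← f.map_abs]; exact f.mono h) hb }, by
    convert (ofHom (M.valHom.comp f)).2 using 1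
    refine SetLike.ext fun a => Iff.trans ?_ LIdeal.mem_ker.symm
    exact val_eq_zero.symm⟩

theorem comap_val (f : LAlgHom A B) (M : Yosida B) (a : A) : (comap f M).val a = M.val (f a) := by
  refine val_eq ?_
  change f (a - algebraMap ℝ A (M.val (f a))) ∈ M.1
  rw [map_sub, f.map_real]
  exact M.sub_val_mem _

theorem continuous_comap (f : LAlgHom A B) : Continuous (comap f) := by
  refine isInducing_val.continuous_iff.2 (continuous_pi fun a => ?_)
  simp only [Function.comp_def, comap_val]
  exact continuous_val (f a)

end

end Yosida

/-! ## The functors `Y`, `C` and `V` -/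

/-- The contravariant functor `Y`, sending an algebra to its Yosida space and a morphism `f` to
`M ↦ f⁻¹(M)`. -/
noncomputable def Y : BAL.{u}ᵒᵖ ⥤ CompHaus.{u} where
  obj A := CompHaus.of (Yosida A.unop)
  map f := CompHausLike.ofHom _ ⟨Yosida.comap (BAL.toHom f.unop), Yosida.continuous_comap _⟩
  map_id _ := rfl
  map_comp _ _ := rfl

instance (X : Type*) [TopologicalSpace X] [CompactSpace X] : IsBAL C(X, ℝ) where
  add_le_add' _ _ _ h x := add_le_add_left (h x) _
  mul_nonneg' _ _ h k x := mul_nonneg (h x) (k x)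
  smul_nonneg' _ _ h k x := mul_nonneg h (k x)
  bounded f := by
    obtain ⟨n, hn⟩ := exists_nat_ge ‖f‖
    refine ⟨n, fun x => ?_⟩
    simp only [nsmul_eq_mul, mul_one]
    exact ((le_abs_self _).trans (f.norm_coe_le_norm x)).trans hn
  archimedean f g h x := IsBAL.archimedean (f x) (g x) fun n => h n x

/-- The morphism `f ↦ f ∘ φ`. -/
def compHom {X Z : Type*} [TopologicalSpace X] [TopologicalSpace Z] (φ : C(X, Z)) :
    LAlgHom C(Z, ℝ) C(X, ℝ) where
  toAlgHom := ContinuousMap.compRightAlgHom ℝ ℝ φ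
  map_sup' _ _ := rfl
  map_inf' _ _ := rfl

theorem compHom_apply {X Z : Type*} [TopologicalSpace X] [TopologicalSpace Z] (φ : C(X, Z))
    (f : C(Z, ℝ)) (x : X) : compHom φ f x = f (φ x) := rfl

/-- The contravariant functor `C`, sending a compact Hausdorff space `X` to `C(X)` and a continuous
map `φ` to `f ↦ f ∘ φ`. -/
noncomputable def C : CompHaus.{u}ᵒᵖ ⥤ BAL.{u} where
  obj X := { carrier := C(X.unop, ℝ) }
  map φ := BAL.ofHom (compHom (ConcreteCategory.hom φ.unop))
  map_id _ := rfl
  map_comp _ _ := rfl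

/-- The Vietoris functor `V` on compact Hausdorff spaces. The points of `V X` are the closed
(equivalently, compact) subsets of `X`, including the empty set; the topology is generated by the
sets `{F | F ⊆ U}` and `{F | F ∩ U ≠ ∅}` for `U` open; a continuous map acts by direct image. -/
def V : CompHaus.{u} ⥤ CompHaus.{u} where
  obj X := CompHaus.of (Compacts X)
  map φ := CompHausLike.ofHom _
    ⟨Compacts.map (ConcreteCategory.hom φ) (ConcreteCategory.hom φ).continuous,
      Continuous.compacts_map (ConcreteCategory.hom φ).continuous⟩
  map_id _ := ConcreteCategory.hom_ext _ _ fun F => Compacts.map_id F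
  map_comp f g := ConcreteCategory.hom_ext _ _ fun F =>
    Compacts.map_comp _ _ (ConcreteCategory.hom g).continuous
      (ConcreteCategory.hom f).continuous F

open Opposite

/-! ## The unit and counit of Gelfand duality -/

section GelfandUnit

/-- The function `ζ_A(a)` on the Yosida space: `ζ_A(a)(M) = r` where `a + M = r + M`. -/
noncomputable def zetaHom (A : Type u) [CommRing A] [Lattice A] [Algebra ℝ A] [IsBAL A] :
    LAlgHom A C(Yosida A, ℝ) where
  toFun a := ⟨fun M => M.val a, Yosida.continuous_val a⟩
  map_zero' := ContinuousMap.ext fun M => map_zero M.valHom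
  map_one' := ContinuousMap.ext fun M => map_one M.valHom
  map_add' a b := ContinuousMap.ext fun M => map_add M.valHom a b
  map_mul' a b := ContinuousMap.ext fun M => map_mul M.valHom a b
  commutes' r := ContinuousMap.ext fun M => M.valHom.map_real r
  map_sup' a b := ContinuousMap.ext fun M => M.valHom.map_sup a b
  map_inf' a b := ContinuousMap.ext fun M => M.valHom.map_inf a b

/-- `ζ_A : A → C(Y_A)` as a morphism in the category. -/
noncomputable def ζ (A : BAL.{u}) : A ⟶ C.obj (op (Y.obj (op A))) := BAL.ofHom (zetaHom A)

variable (X : Type u) [TopologicalSpace X]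

/-- Evaluation at a point. -/
def evalHom {X : Type u} [TopologicalSpace X] (x : X) : LAlgHom C(X, ℝ) ℝ where
  toAlgHom := ContinuousMap.evalAlgHom ℝ ℝ x
  map_sup' _ _ := rfl
  map_inf' _ _ := rfl

variable [CompactSpace X]

/-- The map `x ↦ {f | f(x) = 0}` from `X` to the Yosida space of `C(X)`. -/
def epsMap : C(X, Yosida C(X, ℝ)) where
  toFun x := Yosida.ofHom (evalHom x)
  continuous_toFun := by
    refine Yosida.isInducing_val.continuous_iff.2 (continuous_pi fun f => ?_)
    simp only [Function.comp_def, Yosida.ofHom_val]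
    exact f.continuous

theorem epsMap_val (x : X) (f : C(X, ℝ)) : (epsMap X x).val f = f x := Yosida.ofHom_val _ _

theorem epsMap_bijective [T2Space X] : Function.Bijective (epsMap X) := by
  constructor
  · intro x y h
    by_contra hne
    obtain ⟨f, hf0, hf1, -⟩ := exists_continuous_zero_one_of_isClosed
      (isClosed_singleton (x := x)) (isClosed_singleton (x := y))
      (Set.disjoint_singleton.2 hne)
    have h1 := epsMap_val X x f
    rw [h, epsMap_val, hf0 rfl, hf1 rfl] at h1
    exact one_ne_zero h1
  · intro M
    have hx : ∃ x : X, ∀ f ∈ M.1, f x = 0 := by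
      by_contra hcon
      push Not at hcon
      obtain ⟨t, ht⟩ := isCompact_univ.elim_finite_subfamily_closed
        (fun f : {f : C(X, ℝ) // f ∈ M.1} => {x : X | f.1 x = 0})
        (fun f => isClosed_eq f.1.continuous continuous_const)
        (by
          rw [Set.univ_inter]
          refine Set.eq_empty_of_forall_notMem fun x hx => ?_
          obtain ⟨f, hf, hfx⟩ := hcon x
          exact hfx (Set.mem_iInter.1 hx ⟨f, hf⟩))
      have hpos : ∀ x, (∑ f ∈ t, f.1 * f.1) x ≠ 0 := by
        intro x h0
        rw [ContinuousMap.sum_apply] at h0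
        have h1 := (Finset.sum_eq_zero_iff_of_nonneg fun f _ => mul_self_nonneg (f.1 x)).1 h0
        have : x ∈ (Set.univ ∩ ⋂ f ∈ t, {x : X | f.1 x = 0}) := by
          refine ⟨trivial, Set.mem_iInter₂.2 fun f hf => ?_⟩
          exact mul_self_eq_zero.1 (h1 f hf)
        rw [ht] at this
        exact this
      have hmem : (∑ f ∈ t, f.1 * f.1) ∈ M.1 :=
        sum_mem fun f _ => M.1.mul_mem_left _ f.2
      refine M.2.1 ?_
      have h2 := M.1.mul_mem_left
        (⟨fun x => ((∑ f ∈ t, f.1 * f.1) x)⁻¹, (map_continuous _).inv₀ hpos⟩ : C(X, ℝ)) hmem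
      convert h2 using 1
      ext x
      exact (inv_mul_cancel₀ (hpos x)).symm
    obtain ⟨x, hx⟩ := hx
    exact ⟨x, Subtype.ext (M.2.2 (epsMap X x).1 (fun f hf => Yosida.mem_ofHom.2 (hx f hf))
      (epsMap X x).2.1)⟩

/-- `ε_X : X → Y_{C(X)}` as a morphism in the category. -/
noncomputable def ε (X : CompHaus.{u}) : X ⟶ Y.obj (op (C.obj (op X))) := CompHausLike.ofHom _ (epsMap X)

instance (X : CompHaus.{u}) : IsIso (ε X) :=
  CompHausLike.isIso_of_bijective _ (epsMap_bijective X)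

theorem ε_naturality {X Z : CompHaus.{u}} (φ : X ⟶ Z) :
    φ ≫ ε Z = ε X ≫ Y.map (C.map φ.op).op := by
  refine ConcreteCategory.hom_ext _ _ fun x => Yosida.ext fun f => ?_
  exact (epsMap_val Z (ConcreteCategory.hom φ x) f).trans
    ((Yosida.comap_val (BAL.toHom (C.map φ.op)) (epsMap X x) f).trans
      (epsMap_val X x (BAL.toHom (C.map φ.op) f))).symm

end GelfandUnit

/-! ## The morphism `η_A : H(A) → C(V Y_A)` -/

section Eta

section
variable {X : Type u} [TopologicalSpace X]

open Classical in
/-- The function on closed sets that sends `F` to `inf f(F)` if `F` is nonempty, and to `1` if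
`F` is empty. -/
noncomputable def infFun (f : C(X, ℝ)) (F : Compacts X) : ℝ :=
  if F = ⊥ then 1 else sInf (f '' F)

theorem infFun_bot (f : C(X, ℝ)) : infFun f ⊥ = 1 := if_pos rfl

theorem infFun_spec (f : C(X, ℝ)) {F : Compacts X} (h : F ≠ ⊥) :
    ∃ x ∈ F, infFun f F = f x ∧ ∀ y ∈ F, f x ≤ f y := by
  have hne : (F : Set X).Nonempty := by
    rw [Set.nonempty_iff_ne_empty]
    exact fun h0 => h (SetLike.coe_injective h0)
  obtain ⟨x, hx, hinf, hle⟩ := F.isCompact.exists_sInf_image_eq_and_le hne f.continuous.continuousOn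
  exact ⟨x, hx, (if_neg h).trans hinf, hle⟩

theorem infFun_eq {f : C(X, ℝ)} {F : Compacts X} {x : X} (hx : x ∈ F) (h : ∀ y ∈ F, f x ≤ f y) :
    infFun f F = f x := by
  have hF : F ≠ ⊥ := by
    rintro rfl
    exact hx
  obtain ⟨y, hy, h1, h2⟩ := infFun_spec f hF
  rw [h1]
  exact le_antisymm (h2 x hx) (h y hy)

theorem infFun_continuous [T2Space X] (f : C(X, ℝ)) : Continuous (infFun f) := by
  have hbot : IsClopen {(⊥ : Compacts X)} := Compacts.isClopen_singleton_bot
  refine OrderTopology.continuous_iff.2 fun r => ⟨?_, ?_⟩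
  · have hU : IsOpen {F : Compacts X | (F : Set X) ⊆ f ⁻¹' Set.Ioi r} :=
      Compacts.isOpen_subsets_of_isOpen (isOpen_Ioi.preimage f.continuous)
    have key : ∀ F : Compacts X, F ≠ ⊥ →
        (infFun f F ∈ Set.Ioi r ↔ (F : Set X) ⊆ f ⁻¹' Set.Ioi r) := by
      intro F hF
      obtain ⟨x, hx, h1, h2⟩ := infFun_spec f hF
      rw [h1]
      exact ⟨fun h y hy => lt_of_lt_of_le h (h2 y hy), fun h => h hx⟩
    by_cases hr : r < 1
    · convert hU using 1
      ext F
      by_cases hF : F = ⊥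
      · subst hF
        simp [infFun_bot, hr]
      · exact key F hF
    · convert hU.inter hbot.compl.isOpen using 1
      ext F
      by_cases hF : F = ⊥
      · subst hF
        simp [infFun_bot, hr]
      · exact (key F hF).trans ⟨fun h => ⟨h, hF⟩, fun h => h.1⟩
  · have hU : IsOpen {F : Compacts X | ((F : Set X) ∩ f ⁻¹' Set.Iio r).Nonempty} :=
      Compacts.isOpen_inter_nonempty_of_isOpen (isOpen_Iio.preimage f.continuous)
    have key : ∀ F : Compacts X, F ≠ ⊥ →
        (infFun f F ∈ Set.Iio r ↔ ((F : Set X) ∩ f ⁻¹' Set.Iio r).Nonempty) := by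
      intro F hF
      obtain ⟨x, hx, h1, h2⟩ := infFun_spec f hF
      rw [h1]
      exact ⟨fun h => ⟨x, hx, h⟩, fun ⟨y, hy, h⟩ => lt_of_le_of_lt (h2 y hy) h⟩
    by_cases hr : 1 < r
    · convert hU.union hbot.isOpen using 1
      ext F
      by_cases hF : F = ⊥
      · subst hF
        simp [infFun_bot, hr]
      · exact (key F hF).trans ⟨fun h => Or.inl h, fun h => h.resolve_right hF⟩
    · convert hU using 1
      ext F
      by_cases hF : F = ⊥
      · subst hF
        simp [infFun_bot, hr]
      · exact key F hF

/-- `infFun` as a map `C(X) → C(V X)`. -/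
noncomputable def infMap [T2Space X] (f : C(X, ℝ)) : C(Compacts X, ℝ) :=
  ⟨infFun f, infFun_continuous f⟩

theorem infMap_apply [T2Space X] (f : C(X, ℝ)) (F : Compacts X) : infMap f F = infFun f F := rfl

theorem infFun_real (r : ℝ) {F : Compacts X} (h : F ≠ ⊥) :
    infFun (algebraMap ℝ C(X, ℝ) r) F = r := by
  obtain ⟨x, -, h1, -⟩ := infFun_spec (algebraMap ℝ C(X, ℝ) r) h
  exact h1

theorem infMap_isModal [T2Space X] : IsModal (infMap : C(X, ℝ) → C(Compacts X, ℝ)) where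
  inf f g := by
    ext F
    change infFun (f ⊓ g) F = infFun f F ⊓ infFun g F
    by_cases hF : F = ⊥
    · subst hF; simp [infFun_bot]
    · obtain ⟨x, hx, h1, h2⟩ := infFun_spec f hF
      obtain ⟨y, hy, h3, h4⟩ := infFun_spec g hF
      obtain ⟨z, hz, h5, h6⟩ := infFun_spec (f ⊓ g) hF
      rw [h1, h3, h5]
      refine le_antisymm (le_inf ((h6 x hx).trans inf_le_left) ((h6 y hy).trans inf_le_right)) ?_
      exact inf_le_inf (h2 z hz) (h4 z hz)
  real r := by
    ext F
    change infFun (algebraMap ℝ C(X, ℝ) r) F = r + (1 - r) * infFun 0 F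
    by_cases hF : F = ⊥
    · subst hF; simp [infFun_bot]
    · have := infFun_real (X := X) 0 hF
      rw [map_zero] at this
      rw [infFun_real r hF, this]; ring
  pos f := by
    ext F
    change infFun (f ⊔ 0) F = infFun f F ⊔ 0
    by_cases hF : F = ⊥
    · subst hF; simp [infFun_bot]
    · obtain ⟨x, hx, h1, h2⟩ := infFun_spec f hF
      rw [h1]
      exact infFun_eq (f := f ⊔ 0) hx fun y hy => sup_le_sup_right (h2 y hy) 0
  add_real f r := by
    ext F
    change infFun (f + algebraMap ℝ C(X, ℝ) r) F =
      infFun f F + infFun (algebraMap ℝ C(X, ℝ) r) F - infFun 0 F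
    by_cases hF : F = ⊥
    · subst hF; simp [infFun_bot]
    · obtain ⟨x, hx, h1, h2⟩ := infFun_spec f hF
      have := infFun_real (X := X) 0 hF
      rw [map_zero] at this
      rw [h1, infFun_real r hF, this, sub_zero]
      exact infFun_eq (f := f + algebraMap ℝ C(X, ℝ) r) hx fun y hy => add_le_add_left (h2 y hy) r
  smul f r hr := by
    ext F
    change infFun (r • f) F = infFun (algebraMap ℝ C(X, ℝ) r) F * infFun f F
    by_cases hF : F = ⊥
    · subst hF; simp [infFun_bot]
    · obtain ⟨x, hx, h1, h2⟩ := infFun_spec f hF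
      rw [h1, infFun_real r hF]
      exact infFun_eq (f := r • f) hx fun y hy => mul_le_mul_of_nonneg_left (h2 y hy) hr

end

section
variable (A : Type u) [CommRing A] [Lattice A] [Algebra ℝ A] [IsBAL A]

/-- The map `g_A : A → C(V Y_A)`, with `g_A(a)(F) = inf ζ_A(a)(F)` for `F ≠ ∅` and
`g_A(a)(∅) = 1`. -/
noncomputable def gMap (a : A) : C(Compacts (Yosida A), ℝ) := infMap (zetaHom A a)

theorem gMap_isModal : IsModal (gMap A) := infMap_isModal.comp_hom (zetaHom A)

theorem gMap_isWeighted : IsWeighted (weight A) (gMap A) := by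
  intro a
  refine norm_le (zero_le_one.trans (le_max_right _ _)) fun F => ?_
  change |infFun (zetaHom A a) F| ≤ max (norm a) 1
  by_cases hF : F = ⊥
  · subst hF
    rw [infFun_bot, abs_one]
    exact le_max_right _ _
  · obtain ⟨M, -, h1, -⟩ := infFun_spec (zetaHom A a) hF
    rw [h1]
    exact (_root_.abs_le.2 (M.val_mem_Icc a)).trans (le_max_left _ _)

/-- `η_A : H(A) → C(V Y_A)`, the morphism with `η_A(□_a) = g_A(a)`. -/
noncomputable def etaHom : LAlgHom (HObj A) C(Compacts (Yosida A), ℝ) :=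
  HObj.lift { carrier := C(Compacts (Yosida A), ℝ) } (gMap A) (gMap_isWeighted A) (gMap_isModal A)

theorem etaHom_box (a : A) : etaHom A (box a) = gMap A a := rfl

end

/-- `η_A` as a morphism in the category. -/
noncomputable def η (A : BAL.{u}) : H.obj A ⟶ C.obj (op (V.obj (Y.obj (op A)))) :=
  BAL.ofHom (etaHom A)

theorem η_naturality {A B : BAL.{u}} (γ : A ⟶ B) :
    H.map γ ≫ η B = η A ≫ C.map (V.map (Y.map γ.op)).op := by
  refine HObj.hom_ext fun a => ContinuousMap.ext fun (F : Compacts (Yosida B)) => ?_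
  change infFun (zetaHom B (BAL.toHom γ a)) F =
    infFun (zetaHom A a) (F.map (Yosida.comap (BAL.toHom γ)) (Yosida.continuous_comap _))
  have hz : ∀ M : Yosida B, zetaHom B (BAL.toHom γ a) M =
      zetaHom A a (Yosida.comap (BAL.toHom γ) M) :=
    fun M => (Yosida.comap_val (BAL.toHom γ) M a).symm
  by_cases hF : F = ⊥
  · subst hF
    rw [infFun_bot, show (⊥ : Compacts (Yosida B)).map _ (Yosida.continuous_comap (BAL.toHom γ)) = ⊥ from
      SetLike.coe_injective (Set.image_empty _), infFun_bot]
  · obtain ⟨M, hM, h1, h2⟩ := infFun_spec (zetaHom B (BAL.toHom γ a)) hF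
    rw [h1, hz]
    refine (infFun_eq (Set.mem_image_of_mem _ hM) ?_).symm
    rintro _ ⟨N, hN, rfl⟩
    rw [← hz, ← hz]
    exact h2 N hN

end Eta

/-! ## `Y(η_A)` is a homeomorphism -/

section Homeo

variable {A : Type u} [CommRing A] [Lattice A] [Algebra ℝ A] [IsBAL A]

theorem exists_maximal (I : LIdeal A) (hI : (1 : A) ∉ I) : ∃ M : Yosida A, I ≤ M.1 := by
  obtain ⟨M, hIM, hM⟩ := zorn_le_nonempty₀ {J : LIdeal A | (1 : A) ∉ J} (by
    intro c hc hchain J hJ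
    have hdir : DirectedOn (· ≤ ·) (LIdeal.toIdeal '' c) := by
      rintro _ ⟨J, hJ, rfl⟩ _ ⟨K, hK, rfl⟩
      obtain ⟨L, hL, h1, h2⟩ := hchain.directedOn J hJ K hK
      exact ⟨_, ⟨L, hL, rfl⟩, h1, h2⟩
    have hmem : ∀ a : A, a ∈ sSup (LIdeal.toIdeal '' c) ↔ ∃ K ∈ c, a ∈ K := fun a => by
      rw [Submodule.mem_sSup_of_directed (Set.Nonempty.image _ ⟨J, hJ⟩) hdir]
      simp only [Set.exists_mem_image]
      rfl
    refine ⟨⟨sSup (LIdeal.toIdeal '' c), fun a b h hb => ?_⟩, ?_, fun K hK a ha => ?_⟩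
    · obtain ⟨K, hK, hbK⟩ := (hmem b).1 hb
      exact (hmem a).2 ⟨K, hK, K.mem_of_abs_le h hbK⟩
    · intro h1
      obtain ⟨K, hK, h1K⟩ := (hmem 1).1 h1
      exact hc hK h1K
    · exact (hmem a).2 ⟨K, hK, ha⟩) I hI
  exact ⟨⟨M, hM.1, fun J hJ h1 => le_antisymm (hM.2 h1 hJ) hJ⟩, hIM⟩

/-- The order of `A` is determined by the real values of its elements. -/
theorem nonneg_of_val {a : A} (h : ∀ M : Yosida A, 0 ≤ M.val a) : 0 ≤ a := by
  by_contra hneg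
  set b := -a ⊔ 0
  have hb : ¬ ∀ n : ℕ, n • b ≤ 1 := fun hn => by
    have h1 := (le_sup_left : -a ≤ b).trans (IsBAL.archimedean b 1 hn)
    exact hneg (by simpa using h1)
  push Not at hb
  obtain ⟨n, hn⟩ := hb
  set d := n • b - 1
  have hd : ¬ d ≤ 0 := fun h0 => hn (sub_nonpos.1 h0)
  have hdisj : (d ⊔ 0) ⊓ (-d ⊔ 0) = 0 := posPart_inf_negPart_eq_zero d
  let I : LIdeal A :=
    { toIdeal := 0
      solid := fun x y hxy hy => by
        have hy0 : y = 0 := hy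
        rw [hy0, abs_zero] at hxy
        exact le_antisymm ((le_abs_self x).trans hxy) (neg_nonpos.1 ((neg_le_abs x).trans hxy)) }
  have hprop : (1 : A) ∉ I.adjoin (-d ⊔ 0) := by
    rintro ⟨m, hm, -, k, hk⟩
    have hm0 : m = 0 := hm
    rw [hm0, zero_add] at hk
    have h1 : (1 : A) ≤ k • (-d ⊔ 0) := (le_abs_self 1).trans hk
    have hd0 : (0 : A) ≤ d ⊔ 0 := le_sup_right
    have h2 := inf_nsmul_le hd0 (le_sup_right : (0 : A) ≤ -d ⊔ 0) k
    rw [hdisj, nsmul_zero] at h2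
    obtain ⟨j, -, hj⟩ := exists_abs_le (d ⊔ 0)
    have h3 := inf_nsmul_le hd0 zero_le_one j
    rw [inf_eq_left.2 ((le_abs_self _).trans hj)] at h3
    have h4 : (d ⊔ 0) ⊓ 1 ≤ 0 := (inf_le_inf_left _ h1).trans h2
    have h5 := h3.trans (nsmul_le_nsmul_right h4 j)
    rw [nsmul_zero] at h5
    exact hd (le_sup_left.trans h5)
  obtain ⟨M, hM⟩ := exists_maximal _ hprop
  have hmem : -d ⊔ 0 ∈ M.1 :=
    hM ⟨0, rfl, le_rfl, 1, by rw [abs_of_nonneg le_sup_right, one_nsmul, zero_add]⟩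
  have h1 : M.valHom (-d ⊔ 0) = 0 := Yosida.val_eq_zero.2 hmem
  rw [LAlgHom.map_sup, map_neg, map_zero, sup_eq_right, neg_nonpos, map_sub, map_nsmul, map_one,
    LAlgHom.map_sup, map_neg, map_zero, show -M.valHom a ⊔ 0 = 0 from sup_eq_right.2 (neg_nonpos.2 (h M)), nsmul_zero] at h1
  norm_num at h1

/-- The map `F ↦ Y(η_A)(ε(F))` from closed subsets of the Yosida space to the Yosida space of
`H(A)`. -/
noncomputable def etaSpace (F : Compacts (Yosida A)) : Yosida (HObj A) :=
  Yosida.comap (etaHom A) (epsMap (Compacts (Yosida A)) F)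

theorem etaSpace_val (F : Compacts (Yosida A)) (a : A) :
    (etaSpace F).val (box a) = infFun (zetaHom A a) F := by
  rw [etaSpace, Yosida.comap_val, epsMap_val]
  rfl

theorem etaSpace_le {F G : Compacts (Yosida A)} (h : etaSpace F = etaSpace G) :
    (F : Set (Yosida A)) ⊆ G := by
  have hv : ∀ a : A, infFun (zetaHom A a) F = infFun (zetaHom A a) G := fun a => by
    rw [← etaSpace_val, ← etaSpace_val, h]
  intro y hy
  by_contra hyG
  have hF : F ≠ ⊥ := by
    rintro rfl
    exact hy
  have hF0 := infFun_real (X := Yosida A) 0 hF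
  have hG : G ≠ ⊥ := by
    rintro rfl
    have h0 := hv 0
    rw [infFun_bot, map_zero] at h0
    rw [map_zero, h0] at hF0
    exact one_ne_zero hF0
  obtain ⟨I, hI⟩ := Yosida.isClosed_iff.1 G.isCompact.isClosed
  rw [hI, Yosida.mem_zeroSet] at hyG
  push Not at hyG
  obtain ⟨a, ha, hay⟩ := hyG
  obtain ⟨M, hM, h1, -⟩ := infFun_spec (zetaHom A (-|a|)) hG
  obtain ⟨N, -, h3, h4⟩ := infFun_spec (zetaHom A (-|a|)) hF
  have hM0 : M.val a = 0 := by
    have hMG : M ∈ (G : Set (Yosida A)) := hM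
    rw [hI, Yosida.mem_zeroSet] at hMG
    exact hMG a ha
  have hz : ∀ P : Yosida A, zetaHom A (-|a|) P = -|P.val a| := fun P => by
    change P.valHom _ = _
    rw [map_neg, LAlgHom.map_abs]; rfl
  have h5 := h4 y hy
  rw [← h3, hv, h1, hz, hz, hM0, abs_zero, neg_zero, Left.nonneg_neg_iff] at h5
  exact hay (abs_eq_zero.1 (le_antisymm h5 (abs_nonneg _)))

theorem etaSpace_surjective : Function.Surjective (etaSpace (A := A)) := by
  classical
  intro P
  set p : A → ℝ := fun a => P.valHom (box a) with hp
  suffices h : ∃ F : Compacts (Yosida A), ∀ a, infFun (zetaHom A a) F = p a by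
    obtain ⟨F, hF⟩ := h
    refine ⟨F, Yosida.ext fun x => ?_⟩
    have : (etaSpace F).valHom = P.valHom := HObj.hom_ext fun a => (etaSpace_val F a).trans (hF a)
    exact DFunLike.congr_fun this x
  have p_inf : ∀ a b, p (a ⊓ b) = p a ⊓ p b := fun a b => by
    simp only [hp, box_inf, LAlgHom.map_inf]
  have p_smul : ∀ a (r : ℝ), 0 ≤ r → p (r • a) = p (algebraMap ℝ A r) * p a := fun a r hr => by
    simp only [hp, box_smul a hr, map_mul]
  have p_add : ∀ a (r : ℝ), p (a + algebraMap ℝ A r) = p a + p (algebraMap ℝ A r) - p 0 :=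
    fun a r => by simp only [hp, box_add_real, map_add, map_sub]
  have p_real : ∀ r : ℝ, p (algebraMap ℝ A r) = r + (1 - r) * p 0 := fun r => by
    simp only [hp, box_real r, map_add, map_mul, map_sub, map_one, LAlgHom.map_real,
      Algebra.algebraMap_self_apply]
  have p_zero : ∀ a, p 0 = p 0 * p a := fun a => by
    have := p_smul a 0 le_rfl
    rwa [zero_smul, map_zero] at this
  rcases eq_or_ne (p 0) 0 with h0 | h0
  swap
  · refine ⟨⊥, fun a => ?_⟩
    rw [infFun_bot]
    exact mul_left_cancel₀ h0 ((mul_one _).trans (p_zero a))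
  simp only [h0, mul_zero, add_zero, sub_zero] at p_real p_add
  simp only [p_real] at p_smul p_add
  have p_mono : ∀ a b, a ≤ b → p a ≤ p b := fun a b hab => by
    rw [← inf_eq_left.2 hab, p_inf]; exact inf_le_right
  have hclosed : ∀ a : A, IsClosed {M : Yosida A | p a ≤ M.val a} := fun a =>
    isClosed_le continuous_const (Yosida.continuous_val a)
  let F : Compacts (Yosida A) :=
    ⟨⋂ a : A, {M : Yosida A | p a ≤ M.val a}, (isClosed_iInter hclosed).isCompact⟩
  have memF : ∀ {M}, M ∈ F ↔ ∀ a, p a ≤ M.val a := fun {M} => Set.mem_iInter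
  refine ⟨F, fun a => ?_⟩
  suffices h : ∃ M ∈ F, M.val a ≤ p a by
    obtain ⟨M, hM, hMa⟩ := h
    have e : zetaHom A a M = p a := le_antisymm hMa (memF.1 hM a)
    rw [← e]
    refine infFun_eq hM fun N hN => ?_
    rw [e]; exact memF.1 hN a
  by_contra hcon
  push Not at hcon
  have hK : IsCompact {M : Yosida A | M.val a ≤ p a} := (Yosida.isClosed_val_le a _).isCompact
  obtain ⟨t, ht⟩ := hK.elim_finite_subfamily_closed _ hclosed (by
    refine Set.eq_empty_of_forall_notMem fun M hM => ?_
    exact absurd hM.1 (not_le.2 (hcon M (memF.2 fun a => Set.mem_iInter.1 hM.2 a))))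
  obtain ⟨b, hb0, hbp, hbt⟩ : ∃ b : A, b ≤ 0 ∧ p b = 0 ∧
      ∀ M : Yosida A, 0 ≤ M.val b → ∀ i ∈ t, p i ≤ M.val i := by
    clear ht
    induction t using Finset.induction_on with
    | empty => exact ⟨0, le_rfl, h0, by simp⟩
    | insert i s _ ih =>
      obtain ⟨b, hb0, hbp, hbt⟩ := ih
      refine ⟨b ⊓ (i + algebraMap ℝ A (-p i)), inf_le_left.trans hb0, ?_, fun M hM => ?_⟩
      · rw [p_inf, hbp, p_add]; simp
      · rw [← Yosida.valHom_apply, LAlgHom.map_inf, le_inf_iff, map_add, LAlgHom.map_real] at hM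
        intro j hj
        rcases Finset.mem_insert.1 hj with rfl | hj
        · have := hM.2
          rw [Algebra.algebraMap_self_apply] at this
          rw [← Yosida.valHom_apply]
          linarith
        · exact hbt M hM.1 j hj
  set c : A := a + algebraMap ℝ A (-p a) with hc
  have hcp : p c = 0 := by rw [p_add]; simp
  have hcval : ∀ M : Yosida A, M.val c = M.val a - p a := fun M => by
    rw [← Yosida.valHom_apply, map_add, LAlgHom.map_real]; rfl
  have hpos : ∀ M : Yosida A, 0 ≤ M.val b → 0 < M.val c := by
    intro M hM
    rw [hcval, sub_pos]
    by_contra hle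
    rw [not_lt] at hle
    have : M ∈ ({M : Yosida A | M.val a ≤ p a} ∩ ⋂ i ∈ t, {M : Yosida A | p i ≤ M.val i}) :=
      ⟨hle, Set.mem_iInter₂.2 fun i hi => hbt M hM i hi⟩
    rw [ht] at this
    exact this
  have hcont : ∀ x : A, Continuous fun M : Yosida A => M.val x := Yosida.continuous_val
  have hval0 : ∀ M : Yosida A, M.val b ≤ 0 := fun M => by
    have := M.valHom.mono hb0
    rwa [map_zero] at this
  obtain ⟨δ, hδ, hδc⟩ : ∃ δ : ℝ, 0 < δ ∧ ∀ M : Yosida A, 0 ≤ M.val b → 2 * δ ≤ M.val c := by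
    have hK1 : IsCompact {M : Yosida A | 0 ≤ M.val b} :=
      (isClosed_le continuous_const (hcont b)).isCompact
    rcases Set.eq_empty_or_nonempty {M : Yosida A | 0 ≤ M.val b} with he | hne
    · refine ⟨1, one_pos, fun M hM => ?_⟩
      have : M ∈ {M : Yosida A | 0 ≤ M.val b} := hM
      rw [he] at this
      exact this.elim
    · obtain ⟨M₀, hM₀, hmin⟩ := hK1.exists_isMinOn hne (hcont c).continuousOn
      refine ⟨M₀.val c / 2, half_pos (hpos M₀ hM₀), fun M hM => ?_⟩
      rw [mul_div_cancel₀ _ two_ne_zero]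
      exact hmin hM
  obtain ⟨s, hs, hsb⟩ : ∃ s : ℝ, 0 < s ∧ ∀ M : Yosida A, M.val c ≤ δ → M.val b ≤ -s := by
    have hK2 : IsCompact {M : Yosida A | M.val c ≤ δ} := (Yosida.isClosed_val_le c δ).isCompact
    rcases Set.eq_empty_or_nonempty {M : Yosida A | M.val c ≤ δ} with he | hne
    · refine ⟨1, one_pos, fun M hM => ?_⟩
      have : M ∈ {M : Yosida A | M.val c ≤ δ} := hM
      rw [he] at this
      exact this.elim
    · obtain ⟨M₀, hM₀, hmax⟩ := hK2.exists_isMaxOn hne (hcont b).continuousOn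
      refine ⟨-M₀.val b, ?_, fun M hM => ?_⟩
      · rw [neg_pos]
        by_contra hge
        have h1 := hδc M₀ (not_lt.1 hge)
        have h2 : M₀.val c ≤ δ := hM₀
        linarith
      · rw [neg_neg]; exact hmax hM
  obtain ⟨n, hn⟩ := exists_nat_ge ((norm c + δ) / s)
  rw [div_le_iff₀ hs] at hn
  have hle : (n : ℝ) • b ≤ c + algebraMap ℝ A (-δ) := by
    rw [← sub_nonneg]
    refine nonneg_of_val fun M => ?_
    rw [← Yosida.valHom_apply, map_sub, map_add, LAlgHom.map_real, map_smul, smul_eq_mul,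
      Algebra.algebraMap_self_apply, Yosida.valHom_apply, Yosida.valHom_apply]
    rcases le_total (M.val c) δ with h1 | h1
    · have h2 := hsb M h1
      have h3 := (M.val_mem_Icc c).1
      have h4 : (n : ℝ) * M.val b ≤ n * -s := mul_le_mul_of_nonneg_left h2 (Nat.cast_nonneg n)
      linarith
    · have h4 : (n : ℝ) * M.val b ≤ 0 :=
        mul_nonpos_of_nonneg_of_nonpos (Nat.cast_nonneg n) (hval0 M)
      linarith
  have hfin := p_mono _ _ hle
  rw [p_smul b n (Nat.cast_nonneg n), hbp, mul_zero, p_add, hcp] at hfin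
  linarith

theorem etaSpace_bijective : Function.Bijective (etaSpace (A := A)) :=
  ⟨fun _ _ h => SetLike.coe_injective (Set.Subset.antisymm (etaSpace_le h) (etaSpace_le h.symm)),
    etaSpace_surjective⟩

instance (A : BAL.{u}) : IsIso (Y.map (η A).op) :=
  CompHausLike.isIso_of_bijective _
    ((Function.Bijective.of_comp_iff _ (epsMap_bijective (Compacts (Yosida A)))).1
      (etaSpace_bijective (A := A)))

end Homeo

/-! ## The functors between algebras and coalgebras -/

/-- The contravariant functor from `Alg(H)` to `Coalg(V)`, sending `(A, α)` to the coalgebra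
`ε⁻¹ ∘ Y(η_A)⁻¹ ∘ Y(α) : Y_A → V(Y_A)` and a morphism `γ` to `Y(γ)`. -/
noncomputable def F : (Endofunctor.Algebra H.{u})ᵒᵖ ⥤ Endofunctor.Coalgebra V.{u} where
  obj A :=
    { V := Y.obj (op A.unop.a)
      str := Y.map A.unop.str.op ≫ inv (Y.map (η A.unop.a).op) ≫
        inv (ε (V.obj (Y.obj (op A.unop.a)))) }
  map {A B} γ :=
    { f := Y.map γ.unop.f.op
      h := by
        have h1 := congrArg (fun f => Y.map f.op) γ.unop.h
        have h2 := congrArg (fun f => Y.map f.op) (η_naturality γ.unop.f)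
        have h3 := ε_naturality (V.map (Y.map γ.unop.f.op))
        simp only [op_comp, Functor.map_comp] at h1 h2
        have h4 : inv (Y.map (η A.unop.a).op) ≫ inv (ε (V.obj (Y.obj (op A.unop.a)))) ≫
            V.map (Y.map γ.unop.f.op) = Y.map (H.map γ.unop.f).op ≫
            inv (Y.map (η B.unop.a).op) ≫ inv (ε (V.obj (Y.obj (op B.unop.a)))) := by
          rw [IsIso.inv_comp_eq, IsIso.inv_comp_eq, reassoc_of% h2, IsIso.hom_inv_id_assoc,
            ← reassoc_of% h3, IsIso.hom_inv_id, Category.comp_id]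
        rw [Category.assoc, Category.assoc, h4, reassoc_of% h1] }
  map_id A := by
    refine Endofunctor.Coalgebra.Hom.ext ?_
    exact Y.map_id (op A.unop.a)
  map_comp f g := by
    refine Endofunctor.Coalgebra.Hom.ext ?_
    exact Y.map_comp f.unop.f.op g.unop.f.op

/-- The contravariant functor from `Coalg(V)` to `Alg(H)`, sending `(X, σ)` to the algebra
`C(σ) ∘ CV(ε_X) ∘ η_{C(X)} : H(C(X)) → C(X)` and a morphism `φ` to `C(φ)`. -/
noncomputable def G : (Endofunctor.Coalgebra V.{u})ᵒᵖ ⥤ Endofunctor.Algebra H.{u} where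
  obj X :=
    { a := C.obj (op X.unop.V)
      str := η (C.obj (op X.unop.V)) ≫ C.map (V.map (ε X.unop.V)).op ≫ C.map X.unop.str.op }
  map {X Z} φ :=
    { f := C.map φ.unop.f.op
      h := by
        have h1 := congrArg (fun f => C.map f.op) φ.unop.h
        have h2 := η_naturality (C.map φ.unop.f.op)
        have h3 := congrArg (fun f => C.map (V.map f).op) (ε_naturality φ.unop.f)
        simp only [op_comp, Functor.map_comp] at h1 h3
        rw [reassoc_of% h2, reassoc_of% h3.symm, h1]
        simp only [Category.assoc] }
  map_id X := by
    refine Endofunctor.Algebra.Hom.ext ?_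
    exact C.map_id (op X.unop.V)
  map_comp f g := by
    refine Endofunctor.Algebra.Hom.ext ?_
    exact C.map_comp f.unop.f.op g.unop.f.op

/-- `Alg^u(H)`: the `H`-algebras whose carrier is uniformly complete. -/
def algU : ObjectProperty (Endofunctor.Algebra H.{u}) := fun A => IsUniformlyComplete A.a

/-- The restriction of `F` to `Alg^u(H)`. -/
noncomputable def FU : (algU.{u}.FullSubcategory)ᵒᵖ ⥤ Endofunctor.Coalgebra V.{u} :=
  algU.ι.op ⋙ F

/-- The functor `G`, regarded as a functor into `Alg^u(H)`, provided that its values are uniformly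
complete. -/
noncomputable def GU (hG : ∀ X, algU.{u} (G.obj X)) :
    Endofunctor.Coalgebra V.{u} ⥤ (algU.{u}.FullSubcategory)ᵒᵖ :=
  (algU.lift G hG).rightOp

end VietorisDuality

/-! The duality is Gelfand duality carried to algebras and coalgebras, so two things are needed:
Gelfand duality itself, and the fact that its unit and counit respect the structure maps.

Gelfand duality. The order norm on `C(X)` is the sup norm, so `C(X)` is uniformly complete. For
every bounded archimedean `A` the map `ζ_A` reflects the order (an element with nonnegative value at
every maximal `ℓ`-ideal is nonnegative), hence it is injective and isometric. Its image separates
points, hence is dense by Stone–Weierstrass. When `A` is complete the image is everything and `ζ_A`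
is an isomorphism; `ε_X` is always a homeomorphism. The triangle identities `ε_comp_map_ζ` and
`ζ_comp_map_ε` say that evaluating at a point recovers the value there.

Lifting. That `ζ_A` is a morphism of `H`-algebras (`ζ_comp_algebra`) and `ε_X` a morphism of
`V`-coalgebras (`εCoalg`) follows formally from naturality of `η`, `ζ` and `ε`, the Gelfand triangle
identities, and invertibility of `Y(η)` and of `ε`. Morphisms of algebras and coalgebras are
determined by their underlying morphisms, and the forgetful functors reflect isomorphisms, so
naturality, triangles and invertibility all descend from Gelfand duality.

Reflection. Completeness is used only to invert `ζ`. On all of `Alg(H)` the family `ζ` is still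
natural and satisfies both triangles with `ε`. Since `ε` is invertible, the triangles force `GF(ζ_A)
= ζ_{GF(A)}` (`map_ζAlg`), and this makes `ζ` the unit of an adjunction between `GF` and the
inclusion of `Alg^u(H)`. -/

namespace VietorisDuality

open Opposite

/-! ### Uniform completeness, Stone–Weierstrass, and invertibility of `ζ` -/

section Completeness

theorem norm_le_iff {A : Type u} [CommRing A] [Lattice A] [Algebra ℝ A] [IsBAL A] {a : A} {r : ℝ}
    (hr : 0 ≤ r) : norm a ≤ r ↔ |a| ≤ algebraMap ℝ A r :=
  ⟨fun h => (abs_le_norm a).trans (real_mono h), norm_le hr⟩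

/-- The order on `C(X)` is pointwise, so the two norms have the same upper bounds `r ≥ 0`, and a
negative `r` bounds neither. This turns uniform completeness of `C(X)` into completeness of the
usual Banach space. -/
theorem norm_continuousMap {X : Type u} [TopologicalSpace X] [CompactSpace X] (f : C(X, ℝ)) :
    norm f = ‖f‖ := by
  refine eq_of_forall_ge_iff fun r => ?_
  rcases lt_or_ge r 0 with hr | hr
  · exact iff_of_false (hr.trans_le (norm_nonneg f)).not_ge
      (hr.trans_le (_root_.norm_nonneg f)).not_ge
  · rw [norm_le_iff hr, ContinuousMap.norm_le f hr]
    exact Iff.rfl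

theorem isUniformlyComplete_continuousMap (X : Type u) [TopologicalSpace X] [CompactSpace X] :
    IsUniformlyComplete C(X, ℝ) := by
  intro s hs
  simp only [norm_continuousMap, ← dist_eq_norm] at hs ⊢
  obtain ⟨f, hf⟩ := cauchySeq_tendsto_of_complete
    (Metric.cauchySeq_iff.2 fun ε hε => (hs ε hε).imp fun N h m hm n hn => h m n hm hn)
  exact ⟨f, Metric.tendsto_atTop.1 hf⟩

variable {A : Type u} [CommRing A] [Lattice A] [Algebra ℝ A] [IsBAL A]

theorem zetaHom_apply (a : A) (M : Yosida A) : zetaHom A a M = M.val a := rfl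

/-- There are enough maximal `ℓ`-ideals to detect the order: `nonneg_of_val`, which rests on the
archimedean property, is applied to `b - a`. Injectivity and isometry of `ζ` both come from this. -/
theorem zetaHom_le_iff {a b : A} : zetaHom A a ≤ zetaHom A b ↔ a ≤ b := by
  refine ⟨fun h => sub_nonneg.1 (nonneg_of_val fun M => ?_), (zetaHom A).mono⟩
  rw [← zetaHom_apply, map_sub]
  exact sub_nonneg.2 (h M)

theorem zetaHom_injective : Function.Injective (zetaHom A) := fun _ _ h =>
  le_antisymm (zetaHom_le_iff.1 h.le) (zetaHom_le_iff.1 h.ge)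

/-- Every morphism is norm-decreasing. Conversely, a bound of `|ζ(a)|` by a constant pulls back to
the same bound of `|a|`, because `ζ` preserves constants and absolute values and reflects the order.
-/
theorem norm_zetaHom (a : A) : ‖zetaHom A a‖ = norm a := by
  rw [← norm_continuousMap]
  refine le_antisymm (norm_map_le _ a) (norm_le (norm_nonneg _) ?_)
  rw [← zetaHom_le_iff, LAlgHom.map_abs, LAlgHom.map_real]
  exact abs_le_norm _

/-- Stone–Weierstrass for the image subalgebra. It separates points because a maximal `ℓ`-ideal is
determined by the values it gives to the elements of `A`. -/
theorem zetaHom_denseRange : DenseRange (zetaHom A) := by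
  have h := ContinuousMap.subalgebra_topologicalClosure_eq_top_of_separatesPoints
    (zetaHom A).toAlgHom.range (by
      intro M N hMN
      by_contra hcon
      push Not at hcon
      exact hMN (Yosida.ext fun a => hcon _ ⟨zetaHom A a, ⟨a, rfl⟩, rfl⟩))
  exact dense_iff_closure_eq.2 (congrArg SetLike.coe h)

/-- An isometric image of a complete algebra is closed, and this one is dense. -/
theorem zetaHom_surjective (hA : IsUniformlyComplete A) : Function.Surjective (zetaHom A) := by
  intro f
  obtain ⟨x, hx, hxf⟩ := mem_closure_iff_seq_limit.1 (zetaHom_denseRange f)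
  choose s hs using hx
  obtain rfl : (fun n => zetaHom A (s n)) = x := funext hs
  -- The sequence of images converges to `f`, hence is Cauchy; since `ζ` is isometric, the preimages
  -- `s n` are Cauchy in `A` and have a limit `a`.
  obtain ⟨a, ha⟩ := hA s fun ε hε => by
    obtain ⟨N, hN⟩ := Metric.cauchySeq_iff.1 hxf.cauchySeq ε hε
    refine ⟨N, fun m n hm hn => ?_⟩
    rw [← norm_zetaHom, map_sub, ← dist_eq_norm]
    exact hN m hm n hn
  -- By isometry the images also converge to `ζ(a)`, so `ζ(a) = f` by uniqueness of limits.
  refine ⟨a, tendsto_nhds_unique (Metric.tendsto_atTop.2 fun ε hε => ?_) hxf⟩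
  obtain ⟨N, hN⟩ := ha ε hε
  refine ⟨N, fun n hn => ?_⟩
  rw [dist_eq_norm, ← map_sub, norm_zetaHom]
  exact hN n hn

/-- The inverse of a bijective morphism of `ℓ`-algebras. -/
noncomputable def LAlgHom.inverse {B : Type*} [CommRing B] [Lattice B] [Algebra ℝ B]
    (f : LAlgHom A B) (hf : Function.Bijective f) : LAlgHom B A where
  toAlgHom := (AlgEquiv.ofBijective f.toAlgHom hf).symm.toAlgHom
  map_sup' a b := by
    -- By injectivity the identity may be checked after applying `f`, which preserves joins and
    -- cancels the inverse.
    refine hf.1 ((AlgEquiv.ofBijective f.toAlgHom hf).apply_symm_apply _ |>.trans ?_)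
    rw [f.map_sup]
    exact (congrArg₂ (· ⊔ ·) ((AlgEquiv.ofBijective f.toAlgHom hf).apply_symm_apply a)
      ((AlgEquiv.ofBijective f.toAlgHom hf).apply_symm_apply b)).symm
  map_inf' a b := by
    refine hf.1 ((AlgEquiv.ofBijective f.toAlgHom hf).apply_symm_apply _ |>.trans ?_)
    rw [f.map_inf]
    exact (congrArg₂ (· ⊓ ·) ((AlgEquiv.ofBijective f.toAlgHom hf).apply_symm_apply a)
      ((AlgEquiv.ofBijective f.toAlgHom hf).apply_symm_apply b)).symm

theorem BAL.isIso_of_bijective {A B : BAL.{u}} (f : A ⟶ B)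
    (hf : Function.Bijective (BAL.toHom f)) : IsIso f :=
  ⟨BAL.ofHom ((BAL.toHom f).inverse hf),
    LAlgHom.ext (AlgEquiv.ofBijective (BAL.toHom f).toAlgHom hf).symm_apply_apply,
    LAlgHom.ext (AlgEquiv.ofBijective (BAL.toHom f).toAlgHom hf).apply_symm_apply⟩

theorem isIso_ζ {A : BAL.{u}} (hA : IsUniformlyComplete A) : IsIso (ζ A) :=
  BAL.isIso_of_bijective _ ⟨zetaHom_injective, zetaHom_surjective hA⟩

end Completeness

/-! ### Gelfand triangle identities, and the lift of `ζ` and `ε` to algebras and coalgebras -/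

section Gelfand

theorem ζ_naturality {A B : BAL.{u}} (γ : A ⟶ B) :
    γ ≫ ζ B = ζ A ≫ C.map (Y.map γ.op).op :=
  LAlgHom.ext fun a => ContinuousMap.ext fun (M : Yosida B) =>
    (Yosida.comap_val (BAL.toHom γ) M a).symm

/-- Maximal `ℓ`-ideals are compared through their values: the pullback along `ζ_A` of evaluation at
`M` gives `a` the value `ζ_A(a)(M)`, which is the value of `a` at `M`. -/
theorem ε_comp_map_ζ (A : BAL.{u}) :
    ε (Y.obj (op A)) ≫ Y.map (ζ A).op = 𝟙 (Y.obj (op A)) := by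
  refine ConcreteCategory.hom_ext _ _ fun (M : Yosida A) => Yosida.ext fun a => ?_
  exact (Yosida.comap_val (zetaHom A) (epsMap (Yosida A) M) a).trans (epsMap_val _ M _)

/-- The other triangle: the value of `f` at the ideal of functions vanishing at `x` is `f x`. -/
theorem ζ_comp_map_ε (X : CompHaus.{u}) :
    ζ (C.obj (op X)) ≫ C.map (ε X).op = 𝟙 (C.obj (op X)) :=
  LAlgHom.ext fun f => ContinuousMap.ext fun x => epsMap_val X x f

/-- Both sides equal `η_A` followed by `C(σ)`. The hypothesis is the definition of the structure map
of `F(A, α)` with the inverses cleared, so the argument needs no inverse. -/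
theorem ζ_comp_algebra {A : BAL.{u}} {α : H.obj A ⟶ A}
    {σ : Y.obj (op A) ⟶ V.obj (Y.obj (op A))}
    (h : σ ≫ ε _ ≫ Y.map (η A).op = Y.map α.op) :
    H.map (ζ A) ≫ η _ ≫ C.map (V.map (ε _)).op ≫ C.map σ.op = α ≫ ζ A := by
  -- The contravariant `CV` applied to the triangle identity at `Y_A`.
  have h3 : C.map (V.map (Y.map (ζ A).op)).op ≫ C.map (V.map (ε (Y.obj (op A)))).op = 𝟙 _ := by
    rw [← Functor.map_comp, ← op_comp, ← Functor.map_comp, ε_comp_map_ζ, CategoryTheory.Functor.map_id, op_id,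
      CategoryTheory.Functor.map_id]
  -- On the left, naturality of `η` at `ζ_A` and `h3` leave `η_A` followed by `C(σ)`. On the right,
  -- naturality of `ζ` at `α` produces `CY(α)`, which `h` factors through `CY(η_A)`; naturality of
  -- `ζ` at `η_A` moves `η_A` to the front, and the triangle at `V(Y_A)` cancels `ζ` against `C(ε)`.
  rw [reassoc_of% η_naturality (ζ A), reassoc_of% h3, ζ_naturality, ← h, op_comp, op_comp,
    Functor.map_comp, Functor.map_comp, Category.assoc, ← reassoc_of% ζ_naturality (η A),
    reassoc_of% ζ_comp_map_ε]

/-- `ζ_A` as a morphism of `H`-algebras from `(A, α)` to `GF(A, α)`. -/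
noncomputable def ζAlg (A : Endofunctor.Algebra H.{u}) : A ⟶ G.obj (op (F.obj (op A))) where
  f := ζ A.a
  -- Composing the structure map of `F(A, α)` with `ε` and `Y(η_A)` cancels the two inverses in its
  -- definition and leaves `Y(α)`.
  h := ζ_comp_algebra (by simp [F])

/-- `ε_X` as a morphism of coalgebras from `(X, σ)` to `FG(X, σ)`. -/
noncomputable def εCoalg (X : Endofunctor.Coalgebra V.{u}) : X ⟶ F.obj (op (G.obj (op X))) where
  f := ε X.V
  h := by
    -- The structure map of `FG(X, σ)` written out. By contravariance `Y(η)` comes last in the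
    -- expanded composite, next to its inverse, and cancels.
    change X.str ≫ V.map (ε X.V) = ε X.V ≫ Y.map (η (C.obj (op X.V)) ≫
      C.map (V.map (ε X.V)).op ≫ C.map X.str.op).op ≫ inv (Y.map (η (C.obj (op X.V))).op) ≫
        inv (ε (V.obj (Y.obj (op (C.obj (op X.V))))))
    simp only [op_comp, Functor.map_comp, Category.assoc, IsIso.hom_inv_id_assoc]
    -- Naturality of `ε` at `σ`, then at `V(ε_X)`, moves `ε` to the right until it meets its
    -- inverse.
    rw [← reassoc_of% ε_naturality, ← reassoc_of% ε_naturality, IsIso.hom_inv_id, Category.comp_id]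

end Gelfand

/-! ### The dual equivalence and the reflection -/

section Duality

theorem algU_G (X : (Endofunctor.Coalgebra V.{u})ᵒᵖ) : algU.{u} (G.obj X) :=
  isUniformlyComplete_continuousMap X.unop.V

/-- Forgetting the structure map reflects isomorphisms, and `ε` is a homeomorphism for every compact
Hausdorff space. The same principle gives `isIso_ζAlg`, but there completeness of the carrier is
needed. -/
instance (X : Endofunctor.Coalgebra V.{u}) : IsIso (εCoalg X) :=
  have : IsIso (εCoalg X).f := inferInstanceAs (IsIso (ε X.V))
  Endofunctor.Coalgebra.iso_of_iso _

theorem isIso_ζAlg {A : Endofunctor.Algebra H.{u}} (hA : algU A) : IsIso (ζAlg A) :=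
  have : IsIso (ζAlg A).f := isIso_ζ hA
  Endofunctor.Algebra.iso_of_iso _

/-- Morphisms of algebras and of coalgebras are equal once their underlying morphisms are, so this
identity and the next three are those of Gelfand duality. None of them asks for completeness. -/
theorem ζAlg_naturality {A B : Endofunctor.Algebra H.{u}} (γ : A ⟶ B) :
    γ ≫ ζAlg B = ζAlg A ≫ G.map (F.map γ.op).op :=
  Endofunctor.Algebra.Hom.ext (ζ_naturality γ.f)

theorem εCoalg_naturality {X Z : Endofunctor.Coalgebra V.{u}} (φ : X ⟶ Z) :
    φ ≫ εCoalg Z = εCoalg X ≫ F.map (G.map φ.op).op :=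
  Endofunctor.Coalgebra.Hom.ext (ε_naturality φ.f)

theorem εCoalg_comp_map_ζAlg (A : Endofunctor.Algebra H.{u}) :
    εCoalg (F.obj (op A)) ≫ F.map (ζAlg A).op = 𝟙 (F.obj (op A)) :=
  Endofunctor.Coalgebra.Hom.ext (ε_comp_map_ζ A.a)

theorem ζAlg_comp_map_εCoalg (X : Endofunctor.Coalgebra V.{u}) :
    ζAlg (G.obj (op X)) ≫ G.map (εCoalg X).op = 𝟙 (G.obj (op X)) :=
  Endofunctor.Algebra.Hom.ext (ζ_comp_map_ε X.V)

/-- Both sides become the identity after composition with the isomorphism `G(ε)` at `F(A)`: the left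
by `G` applied to one triangle, the right by the other triangle. This is what makes `GF` idempotent
and gives the left triangle of the reflection. -/
theorem map_ζAlg (A : Endofunctor.Algebra H.{u}) :
    G.map (F.map (ζAlg A).op).op = ζAlg (G.obj (op (F.obj (op A)))) := by
  rw [← cancel_mono (G.map (εCoalg (F.obj (op A))).op), ζAlg_comp_map_εCoalg, ← Functor.map_comp,
    ← op_comp, εCoalg_comp_map_ζAlg, op_id, CategoryTheory.Functor.map_id]

/-- The reflector from `Alg(H)` to `Alg^u(H)`, sending `A` to `GF(A)`. -/
noncomputable def completion : Endofunctor.Algebra H.{u} ⥤ algU.{u}.FullSubcategory :=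
  algU.lift (F.rightOp ⋙ G) fun _ => algU_G _

/-- `ζ_A` as an isomorphism in `Alg^u(H)`. -/
noncomputable def ζIso (A : algU.{u}.FullSubcategory) :
    A ≅ completion.obj A.obj :=
  algU.isoMk (@asIso _ _ _ _ (ζAlg A.obj) (isIso_ζAlg A.property))

/-- The natural isomorphism `1 ≅ GF` on the opposite of `Alg^u(H)`, with inverse `ζ`. -/
noncomputable def unitIso : 𝟭 _ ≅ FU.{u} ⋙ GU algU_G :=
  -- In the opposite category an arrow from `A` to `GF(A)` is a morphism of algebras from `GF(A)` to
  -- `A`, so the forward component is the inverse of `ζ`.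
  NatIso.ofComponents (fun A => (ζIso A.unop).symm.op) fun {A B} γ => by
    have h : γ.unop ≫ (ζIso A.unop).hom = (ζIso B.unop).hom ≫ completion.map γ.unop.hom :=
      ObjectProperty.hom_ext _ (ζAlg_naturality γ.unop.hom)
    refine Quiver.Hom.unop_inj ?_
    change (ζIso B.unop).inv ≫ γ.unop = completion.map γ.unop.hom ≫ (ζIso A.unop).inv
    -- Naturality of the inverses is naturality of `ζ` conjugated by the isomorphisms.
    rw [Iso.eq_comp_inv, Category.assoc, h, Iso.inv_hom_id_assoc]

/-- The natural isomorphism `FG ≅ 1` on `Coalg(V)`, with inverse `ε`. -/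
noncomputable def counitIso : GU algU_G ⋙ FU.{u} ≅ 𝟭 _ :=
  NatIso.ofComponents (fun X => (asIso (εCoalg X)).symm) fun {X Z} φ => by
    change F.map (G.map φ.op).op ≫ inv (εCoalg Z) = inv (εCoalg X) ≫ φ
    rw [IsIso.eq_inv_comp, ← reassoc_of% εCoalg_naturality, IsIso.hom_inv_id, Category.comp_id]

/-- All the maps are invertible, so it suffices to compare inverses, and the inverse of the left
side is `ε` followed by `F(ζ)`, a known triangle. For an equivalence this triangle implies the other
one. -/
theorem map_unitIso_comp_counitIso (A : (algU.{u}.FullSubcategory)ᵒᵖ) :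
    FU.map (unitIso.hom.app A) ≫ counitIso.hom.app (FU.obj A) = 𝟙 (FU.obj A) := by
  have h : FU.mapIso (unitIso.app A) ≪≫ counitIso.app (FU.obj A) = Iso.refl _ :=
    Iso.ext_inv (εCoalg_comp_map_ζAlg A.unop.obj)
  exact congrArg Iso.hom h

/-- The functor `GF` is left adjoint to the inclusion of `Alg^u(H)`. -/
noncomputable def completionAdjunction : completion ⊣ algU.{u}.ι :=
  Adjunction.mkOfUnitCounit
    { unit := { app := ζAlg, naturality := fun _ _ => ζAlg_naturality }
      counit :=
        { app := fun A => (ζIso A).inv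
          naturality := fun A B γ => by
            change completion.map γ.hom ≫ (ζIso B).inv = (ζIso A).inv ≫ γ
            rw [Iso.comp_inv_eq, Category.assoc, Iso.eq_inv_comp]
            exact ObjectProperty.hom_ext _ (ζAlg_naturality γ.hom).symm }
      left_triangle := NatTrans.ext <| funext fun A => by
        -- The reflector sends the unit at `A` to the unit at `GF(A)`, which the counit inverts. The
        -- `𝟙 _` in the middle is the component of the associator.
        have h : completion.map (ζAlg A) = (ζIso (completion.obj A)).hom :=
          ObjectProperty.hom_ext _ (map_ζAlg A)
        refine (congrArg (· ≫ 𝟙 _ ≫ (ζIso (completion.obj A)).inv) h).trans ?_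
        exact (congrArg _ (Category.id_comp _)).trans (Iso.hom_inv_id _)
      right_triangle := NatTrans.ext <| funext fun A => by
        -- On a complete algebra unit and counit are `ζ` and its inverse; `𝟙 _` again comes from the
        -- associator.
        change (ζIso A).hom.hom ≫ 𝟙 _ ≫ (ζIso A).inv.hom = 𝟙 _
        rw [Category.id_comp]
        exact congrArg InducedCategory.Hom.hom (ζIso A).hom_inv_id }

end Duality
end VietorisDuality

theorem mainTheorem1 :
    (∃ hG : ∀ X, VietorisDuality.algU.{u} (VietorisDuality.G.obj X),
      ∃ (unit : 𝟭 _ ≅ VietorisDuality.FU.{u} ⋙ VietorisDuality.GU hG)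
        (counit : VietorisDuality.GU hG ⋙ VietorisDuality.FU.{u} ≅ 𝟭 _),
        (∀ A, VietorisDuality.FU.map (unit.hom.app A) ≫ counit.hom.app (VietorisDuality.FU.obj A) =
          𝟙 (VietorisDuality.FU.obj A)) ∧
        (∀ A : VietorisDuality.algU.{u}.FullSubcategory,
          (unit.inv.app (Opposite.op A)).unop.hom.f = VietorisDuality.ζ A.obj.a) ∧
        (∀ X, (counit.inv.app X).f = VietorisDuality.ε X.V)) ∧
    Nonempty (Reflective VietorisDuality.algU.{u}.ι) :=
  open VietorisDuality in
  -- The components need no proof: both isomorphisms are built from inverses, so their own inverses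
  -- have underlying maps `ζ` and `ε` by definition.
  ⟨⟨algU_G, unitIso, counitIso, map_unitIso_comp_counitIso, fun _ => rfl, fun _ => rfl⟩,
    -- The inclusion of a full subcategory is fully faithful, so a left adjoint is all that remains
    -- to be given.
    ⟨{ L := completion, adj := completionAdjunction }⟩⟩
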